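/- Let $G$ be a connected simple graph (no loops, no multiple edges; $V(G)\neq\emptyset$; finite or infinite, with arbitrary vertex degrees), regarded as a geodesic metric space by identifying every edge with the interval $[0,1]$ and measuring distance by shortest paths; the points of $G$ are thus its vertices and the points in the interiors of its edges. Let $J(G)$ be the set of all vertices and all midpoints of edges of $G$. A geodesic triangle $T=\{x,y,z\}$ consists of three (not necessarily distinct) points and three geodesics $[xy],[yz],[zx]$. It is $\delta$-thin if each side is contained in the closed $\delta$-neighborhood of the union of the other two, and $\delta(T)$ is the infimum of the $\delta\ge 0$ such that $T$ is $\delta$-thin. Let $\delta(G)=\sup_T\delta(T)\in[0,\infty]$ over all geodesic triangles $T$ in $G$; $G$ is hyperbolic if for some finite $\delta\ge0$ all geodesic triangles in $G$ are $\delta$-thin. Let $\mathbb T_v(G)$ be the set of geodesic triangles in $G$ that are cycles (i.e. the union of the sides is a simple closed curve) and whose three vertices belong to $V(G)$, and let $\delta_v(G)\in[0,\infty]$ be the infimum of the $\lambda\ge0$ such that every triangle in $\mathbb T_v(G)$ is $\lambda$-thin. Theorem. For every such $G$, $$\delta_v(G)\le\delta(G)\le 4\,\delta_v(G)+\tfrac12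 .$$ Hence $G$ is hyperbolic if and only if $\delta_v(G)<\infty$. Furthermore, if $G$ is hyperbolic, then $\delta_v(G)$ is a (nonnegative integer) multiple of $1/2$, and, if moreover $G$ is not a tree, there exist a geodesic triangle $T=\{x,y,z\}\in\mathbb T_v(G)$ and a point $p\in[xy]\cap J(G)$ such that $$d\big(p,[xz]\cup[zy]\big)=\delta(T)=\delta_v(G).$$ -/

import Mathlib

open scoped NNReal ENNReal

namespace GraphHyp

/-! ### Geodesic triangles and Gromov hyperbolicity -/

section Metric

variable {X : Type*} [MetricSpace X]

/-- `S` is (the image of) a geodesic `[xy]` joining `x` and `y`, parametrized by arc length. -/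
def IsGeodesicSegment (x y : X) (S : Set X) : Prop :=
  ∃ γ : ℝ → X, γ 0 = x ∧ γ (dist x y) = y ∧
    (∀ s ∈ Set.Icc 0 (dist x y), ∀ t ∈ Set.Icc 0 (dist x y), dist (γ s) (γ t) = |s - t|) ∧
    γ '' Set.Icc 0 (dist x y) = S

/-- `S` is a simple closed curve: the image of a continuous closed curve which takes different
values at different parameters, except that the two endpoints of the curve agree. -/
def IsSimpleClosedCurve (S : Set X) : Prop :=
  ∃ (L : ℝ) (c : ℝ → X), 0 < L ∧ ContinuousOn c (Set.Icc 0 L) ∧ c 0 = c L ∧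
    Set.InjOn c (Set.Ico 0 L) ∧ c '' Set.Icc 0 L = S

variable (X) in
/-- A geodesic triangle: three points and three geodesics joining them. The vertices need not be
distinct. -/
structure GeodesicTriangle where
  /-- the first vertex -/
  x : X
  /-- the second vertex -/
  y : X
  /-- the third vertex -/
  z : X
  /-- the side `[xy]` -/
  xy : Set X
  /-- the side `[yz]` -/
  yz : Set X
  /-- the side `[zx]` -/
  zx : Set X
  isGeodesic_xy : IsGeodesicSegment x y xy
  isGeodesic_yz : IsGeodesicSegment y z yz
  isGeodesic_zx : IsGeodesicSegment z x zx

namespace GeodesicTriangle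

/-- The union of the three sides. -/
def carrier (T : GeodesicTriangle X) : Set X := T.xy ∪ T.yz ∪ T.zx

/-- The triangle is a cycle, that is, a simple closed curve. -/
def IsCycle (T : GeodesicTriangle X) : Prop := IsSimpleClosedCurve T.carrier

/-- `T` is `δ`-thin: every side is contained in the closed `δ`-neighborhood of the union of the
two other sides. -/
def IsThin (T : GeodesicTriangle X) (δ : ℝ) : Prop :=
  T.xy ⊆ Metric.cthickening δ (T.yz ∪ T.zx) ∧
  T.yz ⊆ Metric.cthickening δ (T.zx ∪ T.xy) ∧
  T.zx ⊆ Metric.cthickening δ (T.xy ∪ T.yz)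

/-- The sharp thin constant `δ(T)`: the infimum of the `δ ≥ 0` such that `T` is `δ`-thin. -/
noncomputable def thinConst (T : GeodesicTriangle X) : ℝ≥0∞ :=
  ⨅ (δ : ℝ≥0) (_ : T.IsThin δ), (δ : ℝ≥0∞)

end GeodesicTriangle

variable (X) in
/-- The sharp hyperbolicity constant `δ(X)`, possibly infinite. -/
noncomputable def hypConst : ℝ≥0∞ := ⨆ T : GeodesicTriangle X, T.thinConst

variable (X) in
/-- `X` is hyperbolic: for some `δ ≥ 0`, all geodesic triangles are `δ`-thin. -/
def IsHyperbolic : Prop := ∃ δ : ℝ≥0, ∀ T : GeodesicTriangle X, T.IsThin δ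

end Metric

/-! ### A connected graph as a metric space -/

section Graph

variable {V : Type*}

open Classical in
/-- The points of the metric graph of `G`, in barycentric coordinates: a point is given by
`(1 - t) u + t v`, where `t ∈ [0,1]` and either `u = v` (and then the point is the vertex `u`) or
`[u,v]` is an edge (and then it is the point of that edge at distance `t` from `u`). -/
def MetricGraph (G : SimpleGraph V) (_hG : G.Connected) : Type _ :=
  {x : V → ℝ // ∃ (u v : V) (t : ℝ), (u = v ∨ G.Adj u v) ∧ t ∈ Set.Icc (0 : ℝ) 1 ∧
    x = (1 - t) • Pi.single u (1 : ℝ) + t • Pi.single v (1 : ℝ)}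

namespace MetricGraph

variable {G : SimpleGraph V} {hG : G.Connected}

/-- `r` is the length of one of the candidates for a shortest path from `x` to `y`: either the path
inside an edge `[u,v]` that contains both points, or the path that goes from `x` to an endpoint `u`
of an edge containing `x` (the length of this piece is `1 - x u`), then along a shortest path of
edges to an endpoint `v` of an edge containing `y`, and then to `y`. -/
def IsPathLength (x y : MetricGraph G hG) (r : ℝ) : Prop :=
  (∃ u v, G.Adj u v ∧ x.1.support ⊆ {u, v} ∧ y.1.support ⊆ {u, v} ∧ r = |x.1 u - y.1 u|) ∨
  (∃ u v, x.1 u ≠ 0 ∧ y.1 v ≠ 0 ∧ r = (1 - x.1 u) + G.dist u v + (1 - y.1 v))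

noncomputable instance : Dist (MetricGraph G hG) :=
  ⟨fun x y => sInf {r | IsPathLength x y r}⟩

theorem dist_def (x y : MetricGraph G hG) : dist x y = sInf {r | IsPathLength x y r} := rfl

theorem nonneg (x : MetricGraph G hG) (w : V) : 0 ≤ x.1 w := by
  classical
  obtain ⟨x, u, v, t, h, ht, rfl⟩ := x
  have h1 := ht.1
  have h2 := ht.2
  simp only [Pi.add_apply, Pi.smul_apply, Pi.single_apply, smul_eq_mul]
  split_ifs <;> linarith

theorem le_one (x : MetricGraph G hG) (w : V) : x.1 w ≤ 1 := by
  classical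
  obtain ⟨x, u, v, t, h, ht, rfl⟩ := x
  have h1 := ht.1
  have h2 := ht.2
  simp only [Pi.add_apply, Pi.smul_apply, Pi.single_apply, smul_eq_mul]
  split_ifs <;> linarith

theorem exists_ne_zero (x : MetricGraph G hG) : ∃ u, x.1 u ≠ 0 := by
  classical
  obtain ⟨x, u, v, t, h, ht, rfl⟩ := x
  by_contra! h0
  have hu := h0 u
  have hv := h0 v
  rcases eq_or_ne u v with huv | huv
  · subst huv
    simp at hu
  · simp [huv, huv.symm] at hu hv
    linarith

theorem adj_of_ne_zero (x : MetricGraph G hG) {u v : V} (hu : x.1 u ≠ 0) (hv : x.1 v ≠ 0)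
    (huv : u ≠ v) : G.Adj u v ∧ x.1 u + x.1 v = 1 := by
  classical
  obtain ⟨x, a, b, t, h, ht, rfl⟩ := x
  simp only [Pi.add_apply, Pi.smul_apply, Pi.single_apply, smul_eq_mul] at hu hv ⊢
  by_cases h1 : u = a <;> by_cases h2 : u = b <;> by_cases h3 : v = a <;> by_cases h4 : v = b <;>
    simp_all
  exact h.symm

theorem sum_eq_one (x : MetricGraph G hG) {u v : V} (huv : u ≠ v)
    (h : x.1.support ⊆ {u, v}) : x.1 u + x.1 v = 1 := by
  classical
  have hz : ∀ w, w ≠ u → w ≠ v → x.1 w = 0 := by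
    intro w h1 h2
    by_contra h3
    rcases h h3 with h4 | h4
    · exact h1 h4
    · exact h2 h4
  clear h
  obtain ⟨x, a, b, t, h, ht, rfl⟩ := x
  simp only [Pi.add_apply, Pi.smul_apply, Pi.single_apply, smul_eq_mul] at hz ⊢
  have ha := hz a
  have hb := hz b
  by_cases h1 : u = a <;> by_cases h2 : u = b <;> by_cases h3 : v = a <;> by_cases h4 : v = b <;>
    by_cases h5 : a = b <;> grind

theorem IsPathLength.nonneg {x y : MetricGraph G hG} {r : ℝ} (h : IsPathLength x y r) :
    0 ≤ r := by
  rcases h with ⟨u, v, -, -, -, rfl⟩ | ⟨u, v, -, -, rfl⟩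
  · positivity
  · have h1 := x.le_one u
    have h2 := y.le_one v
    have h3 : (0 : ℝ) ≤ G.dist u v := by positivity
    linarith

theorem IsPathLength.symm {x y : MetricGraph G hG} {r : ℝ} (h : IsPathLength x y r) :
    IsPathLength y x r := by
  rcases h with ⟨u, v, h1, h2, h3, rfl⟩ | ⟨u, v, h1, h2, rfl⟩
  · exact Or.inl ⟨u, v, h1, h3, h2, abs_sub_comm _ _⟩
  · exact Or.inr ⟨v, u, h2, h1, by rw [G.dist_comm]; ring⟩

theorem dist_le {x y : MetricGraph G hG} {r : ℝ} (h : IsPathLength x y r) : dist x y ≤ r :=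
  csInf_le ⟨0, fun _ hs => IsPathLength.nonneg hs⟩ h

theorem support_finite (x : MetricGraph G hG) : x.1.support.Finite := by
  classical
  obtain ⟨x, u, v, t, h, ht, rfl⟩ := x
  refine (Set.toFinite {u, v}).subset fun w hw => ?_
  by_contra hc
  simp only [Set.mem_insert_iff, Set.mem_singleton_iff, not_or] at hc
  exact hw (by simp [hc.1, hc.2])

theorem cases_support (x : MetricGraph G hG) :
    (∃ u, x.1 u = 1) ∨ ∃ u v, G.Adj u v ∧ x.1.support ⊆ {u, v} := by
  classical
  obtain ⟨x, u, v, t, rfl | h, ht, rfl⟩ := x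
  · left
    exact ⟨u, by simp⟩
  · refine Or.inr ⟨u, v, h, fun w hw => ?_⟩
    by_contra hc
    simp only [Set.mem_insert_iff, Set.mem_singleton_iff, not_or] at hc
    exact hw (by simp [hc.1, hc.2])

theorem isPathLength_dist (x y : MetricGraph G hG) : IsPathLength x y (dist x y) := by
  have hfin : {r | IsPathLength x y r}.Finite := by
    refine ((((x.support_finite.union y.support_finite).image
      fun u => |x.1 u - y.1 u|).union (Set.finite_singleton (0 : ℝ))).union
      (Set.Finite.image2 (fun u v => (1 - x.1 u) + G.dist u v + (1 - y.1 v))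
        x.support_finite y.support_finite)).subset ?_
    rintro r (⟨u, v, -, -, -, rfl⟩ | ⟨u, v, hu, hv, rfl⟩)
    · left
      by_cases hu : x.1 u = 0
      · by_cases hv : y.1 u = 0
        · right
          simp [hu, hv]
        · exact Or.inl ⟨u, Or.inr hv, rfl⟩
      · exact Or.inl ⟨u, Or.inl hu, rfl⟩
    · exact Or.inr ⟨u, hu, v, hv, rfl⟩
  obtain ⟨u, hu⟩ := x.exists_ne_zero
  obtain ⟨v, hv⟩ := y.exists_ne_zero
  have hne : {r | IsPathLength x y r}.Nonempty := ⟨_, Or.inr ⟨u, v, hu, hv, rfl⟩⟩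
  exact hne.csInf_mem hfin

theorem dist_adj_triangle (hG : G.Connected) {u v : V} (h : G.Adj u v) (w : V) :
    (G.dist u w : ℝ) ≤ 1 + G.dist v w := by
  have h1 := hG.dist_triangle (u := u) (v := v) (w := w)
  rw [SimpleGraph.dist_eq_one_iff_adj.mpr h] at h1
  exact_mod_cast h1

/-- A path inside an edge followed by a path through vertices. -/
theorem dist_le_aux {x y z : MetricGraph G hG} {u v b : V} (huv : G.Adj u v)
    (hx : x.1.support ⊆ {u, v}) (hz : z.1 b ≠ 0) :
    dist x z ≤ |x.1 u - y.1 u| + ((1 - y.1 u) + G.dist u b + (1 - z.1 b)) := by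
  have h1 := x.sum_eq_one huv.ne hx
  by_cases hxu : x.1 u = 0
  · have hxv : x.1 v = 1 := by linarith
    have h2 : dist x z ≤ _ := dist_le (Or.inr ⟨v, b, by simp [hxv], hz, rfl⟩)
    have h3 := dist_adj_triangle hG huv.symm b
    have h4 := neg_le_abs (x.1 u - y.1 u)
    linarith
  · have h2 : dist x z ≤ _ := dist_le (Or.inr ⟨u, b, hxu, hz, rfl⟩)
    have h4 := neg_le_abs (x.1 u - y.1 u)
    have h5 := le_abs_self (x.1 u - y.1 u)
    linarith

theorem dist_le_aux' {x y z : MetricGraph G hG} {u v a b : V} (huv : G.Adj u v)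
    (hx : x.1.support ⊆ {u, v}) (hy : y.1.support ⊆ {u, v}) (hya : y.1 a ≠ 0) (hz : z.1 b ≠ 0) :
    dist x z ≤ |x.1 u - y.1 u| + ((1 - y.1 a) + G.dist a b + (1 - z.1 b)) := by
  rcases hy hya with rfl | h
  · exact dist_le_aux huv hx hz
  · obtain rfl : a = v := h
    have h1 := x.sum_eq_one huv.ne hx
    have h2 := y.sum_eq_one huv.ne hy
    have h3 : |x.1 u - y.1 u| = |x.1 a - y.1 a| := by
      rw [abs_sub_comm]
      congr 1
      linarith
    rw [h3]
    rw [Set.pair_comm] at hx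
    exact dist_le_aux huv.symm hx hz

theorem dist_symm (x y : MetricGraph G hG) : dist x y = dist y x :=
  le_antisymm (dist_le (isPathLength_dist y x).symm) (dist_le (isPathLength_dist x y).symm)

theorem dist_tri (x y z : MetricGraph G hG) : dist x z ≤ dist x y + dist y z := by
  rcases isPathLength_dist x y with ⟨u, v, huv, hx, hy, h1⟩ | ⟨u, v, hu, hv, h1⟩ <;>
    rcases isPathLength_dist y z with ⟨u', v', huv', hy', hz', h2⟩ | ⟨u', v', hu', hv', h2⟩
  · rw [h1, h2]
    by_cases hint : y.1 u ≠ 0 ∧ y.1 v ≠ 0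
    · have hyuv : u ∈ ({u', v'} : Set V) ∧ v ∈ ({u', v'} : Set V) := ⟨hy' hint.1, hy' hint.2⟩
      have hset : ({u', v'} : Set V) = {u, v} := by
        rcases hyuv with ⟨rfl | h3, h4 | h4⟩
        · exact absurd h4.symm huv.ne
        · obtain rfl : v = v' := h4
          rfl
        · obtain rfl : u = v' := h3
          obtain rfl : v = u' := h4
          exact Set.pair_comm _ _
        · exact absurd (h3.trans (Eq.symm h4)) huv.ne
      have hz := hz'
      rw [hset] at hz
      have e1 := y.sum_eq_one huv.ne hy
      have e2 := z.sum_eq_one huv.ne hz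
      have h3 : |y.1 u' - z.1 u'| = |y.1 u - z.1 u| := by
        rcases (hset ▸ Set.mem_insert u' {v'} : u' ∈ ({u, v} : Set V)) with rfl | h
        · rfl
        · obtain rfl : u' = v := h
          rw [abs_sub_comm]
          congr 1
          linarith
      rw [h3]
      exact (dist_le (Or.inl ⟨u, v, huv, hx, hz, rfl⟩)).trans (abs_sub_le _ _ _)
    · obtain ⟨a, ha⟩ : ∃ a, y.1 a = 1 := by
        have e1 := y.sum_eq_one huv.ne hy
        by_cases h3 : y.1 u = 0
        · exact ⟨v, by linarith⟩
        · have h4 : y.1 v = 0 := by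
            by_contra h4
            exact hint ⟨h3, h4⟩
          exact ⟨u, by linarith⟩
      have ha0 : y.1 a ≠ 0 := by simp [ha]
      obtain ⟨b, hb, hb1⟩ : ∃ b, z.1 b ≠ 0 ∧
          (G.dist a b : ℝ) + (1 - z.1 b) ≤ |y.1 u' - z.1 u'| := by
        have key : ∀ c d, G.Adj c d → z.1.support ⊆ {c, d} → a = c → ∃ b, z.1 b ≠ 0 ∧
            (G.dist a b : ℝ) + (1 - z.1 b) ≤ |y.1 c - z.1 c| := by
          rintro c d hcd hz rfl
          have e2 := z.sum_eq_one hcd.ne hz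
          by_cases h3 : z.1 a = 0
          · have h4 : z.1 d = 1 := by linarith
            refine ⟨d, by simp [h4], ?_⟩
            rw [SimpleGraph.dist_eq_one_iff_adj.mpr hcd, ha, h3, h4]
            norm_num
          · refine ⟨a, h3, ?_⟩
            rw [ha, SimpleGraph.dist_self]
            have := le_abs_self (1 - z.1 a)
            push_cast
            linarith
        rcases hy' ha0 with h | h
        · exact key u' v' huv' hz' h
        · have e1 := y.sum_eq_one huv'.ne hy'
          have e2 := z.sum_eq_one huv'.ne hz'
          have h3 : |y.1 u' - z.1 u'| = |y.1 v' - z.1 v'| := by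
            rw [abs_sub_comm]
            congr 1
            linarith
          rw [h3]
          exact key v' u' huv'.symm (by rwa [Set.pair_comm]) h
      have := dist_le_aux' (z := z) huv hx hy ha0 hb
      rw [ha] at this
      linarith
  · rw [h1, h2]
    exact dist_le_aux' huv hx hy hu' hv'
  · rw [h1, h2, dist_symm]
    have := dist_le_aux' (z := x) huv' hz' hy' hv hu
    rw [abs_sub_comm, G.dist_comm] at this
    linarith
  · rw [h1, h2]
    have h3 : dist x z ≤ _ := dist_le (Or.inr ⟨u, v', hu, hv', rfl⟩)
    have h4 : (G.dist u v' : ℝ) ≤ G.dist u v + G.dist v v' := by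
      exact_mod_cast hG.dist_triangle
    have h5 : (G.dist v v' : ℝ) ≤ (1 - y.1 v) + (1 - y.1 u') + G.dist u' v' := by
      rcases eq_or_ne v u' with rfl | hne
      · have := y.le_one v
        linarith
      · obtain ⟨hadj, hs⟩ := y.adj_of_ne_zero hv hu' hne
        have := dist_adj_triangle hG hadj v'
        linarith
    linarith

theorem ext_of_support {x y : MetricGraph G hG} {u v : V} (huv : u ≠ v)
    (hx : x.1.support ⊆ {u, v}) (hy : y.1.support ⊆ {u, v}) (h : x.1 u = y.1 u) : x = y := by
  have e1 := x.sum_eq_one huv hx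
  have e2 := y.sum_eq_one huv hy
  refine Subtype.ext (funext fun w => ?_)
  by_cases h1 : w = u
  · rw [h1, h]
  by_cases h2 : w = v
  · rw [h2]
    linarith
  have hz : ∀ z : MetricGraph G hG, z.1.support ⊆ {u, v} → z.1 w = 0 := by
    intro z hz
    by_contra h3
    rcases hz h3 with h4 | h4
    · exact h1 h4
    · exact h2 h4
  rw [hz x hx, hz y hy]

theorem eq_zero_of_eq_one (x : MetricGraph G hG) {u w : V} (h : x.1 u = 1) (hw : w ≠ u) :
    x.1 w = 0 := by
  by_contra h1
  exact h1 (by linarith [(x.adj_of_ne_zero h1 (by simp [h]) hw).2])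

noncomputable instance : MetricSpace (MetricGraph G hG) where
  dist_self x := by
    refine le_antisymm ?_ (isPathLength_dist x x).nonneg
    rcases x.cases_support with ⟨u, hu⟩ | ⟨u, v, huv, hx⟩
    · have := dist_le (Or.inr ⟨u, u, by simp [hu], by simp [hu], rfl⟩ : IsPathLength x x _)
      simpa [hu] using this
    · have := dist_le (Or.inl ⟨u, v, huv, hx, hx, rfl⟩ : IsPathLength x x _)
      simpa using this
  dist_comm := dist_symm
  dist_triangle := dist_tri
  eq_of_dist_eq_zero := by
    intro x y h
    rcases isPathLength_dist x y with ⟨u, v, huv, hx, hy, h1⟩ | ⟨u, v, hu, hv, h1⟩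
    · rw [h, eq_comm, abs_eq_zero, sub_eq_zero] at h1
      exact ext_of_support huv.ne hx hy h1
    · have e1 := x.le_one u
      have e2 := y.le_one v
      have e3 : (0 : ℝ) ≤ G.dist u v := by positivity
      have hxu : x.1 u = 1 := by linarith
      have hyv : y.1 v = 1 := by linarith
      have h0 : G.dist u v = 0 := by
        have : (G.dist u v : ℝ) = 0 := by linarith
        exact_mod_cast this
      obtain rfl : u = v := hG.dist_eq_zero_iff.mp h0
      refine Subtype.ext (funext fun w => ?_)
      by_cases hw : w = u
      · rw [hw, hxu, hyv]
      · rw [x.eq_zero_of_eq_one hxu hw, y.eq_zero_of_eq_one hyv hw]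

/-- The point of the metric graph is a vertex of `G`. -/
def IsVertex (x : MetricGraph G hG) : Prop := ∃ v, x.1 v = 1

/-- The point of the metric graph is the midpoint of an edge of `G`. -/
def IsMidpoint (x : MetricGraph G hG) : Prop :=
  ∃ u v, G.Adj u v ∧ x.1 u = 1 / 2 ∧ x.1 v = 1 / 2

variable (G hG) in
/-- `J(G)`: the set of the vertices and of the midpoints of the edges of `G`. -/
def vertexMidpointSet : Set (MetricGraph G hG) := {x | x.IsVertex ∨ x.IsMidpoint}

variable (G hG) in
/-- `𝕋_v(G)`: the set of the geodesic triangles that are cycles and whose three vertices belong to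
`V(G)`. -/
def vertexTriangles : Set (GeodesicTriangle (MetricGraph G hG)) :=
  {T | T.IsCycle ∧ T.x.IsVertex ∧ T.y.IsVertex ∧ T.z.IsVertex}

variable (G hG) in
/-- `δ_v(G)`: the infimum of the `δ ≥ 0` such that all triangles in `𝕋_v(G)` are `δ`-thin. -/
noncomputable def vertexHypConst : ℝ≥0∞ :=
  ⨅ (δ : ℝ≥0) (_ : ∀ T ∈ vertexTriangles G hG, T.IsThin δ), (δ : ℝ≥0∞)

end MetricGraph

end Graph

end GraphHyp

/-! The inequality `δ_v ≤ δ` and the equivalence with hyperbolicity are formal once the upper bound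
is known. That bound rests on one topological fact: a geodesic between vertices is edge-saturated
(`edgeSaturated`), so a non-vertex point of a union of such geodesics is interior to the union, and
another curve can enter or leave the union only at a vertex.

Hence every triangle with corners in `V`, cycle or not, satisfies the bound `δ_v`
(`infEDist_le_of_vertex_triangle`): a point of one side off the other two lies in a maximal gap of
that side, the gap ends at vertices, and the other two sides contain arcs closing the gap up to a
cycle of `𝕋_v`.

For arbitrary corners, each side is trimmed to the part between its first and last vertices, and the
resulting hexagon is cut into triangles with corners in `V`, nested three deep. This gives `δ ≤ 3
δ_v + 1` (`infEDist_le_of_triangle`). If `G` is not a tree, some edge is one side of a triangle in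
`𝕋_v` and its midpoint shows `δ_v ≥ 1/2`, so `3 δ_v + 1 ≤ 4 δ_v + 1/2`. If `G` is a tree, interior
points of edges separate, and `δ = 0`.

For the last claims, the distance to the other two sides is an integer at vertices, and along an
edge it is largest at an endpoint or at the midpoint (`exists_infDist_eq_half`). The values to be
maximised are thus half-integers, and a bounded set of these has a maximum. -/

namespace GraphHyp

/-! ### Concatenation of curves -/

section Curves

variable {X : Type*}

/-- The concatenation of a curve defined on `[0, A]` with another curve. -/
noncomputable def concat (f g : ℝ → X) (A : ℝ) : ℝ → X := fun s => if s ≤ A then f s else g (s - A)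

theorem concat_of_le {f g : ℝ → X} {A s : ℝ} (h : s ≤ A) : concat f g A s = f s := if_pos h

theorem concat_of_ge {f g : ℝ → X} {A s : ℝ} (hfg : f A = g 0) (h : A ≤ s) :
    concat f g A s = g (s - A) := by
  rcases h.eq_or_lt with rfl | h
  · rw [concat_of_le le_rfl, hfg, sub_self]
  · exact if_neg (not_le.mpr h)

theorem image_concat {f g : ℝ → X} {A B : ℝ} (hA : 0 ≤ A) (hB : 0 ≤ B) (hfg : f A = g 0) :
    concat f g A '' Set.Icc 0 (A + B) = f '' Set.Icc 0 A ∪ g '' Set.Icc 0 B := by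
  ext p
  constructor
  · rintro ⟨s, ⟨hs, hs'⟩, rfl⟩
    rcases le_total s A with h | h
    · exact Or.inl ⟨s, ⟨hs, h⟩, (concat_of_le h).symm⟩
    · exact Or.inr ⟨s - A, ⟨by linarith, by linarith⟩, (concat_of_ge hfg h).symm⟩
  · rintro (⟨s, ⟨hs, hs'⟩, rfl⟩ | ⟨s, ⟨hs, hs'⟩, rfl⟩)
    · exact ⟨s, ⟨hs, by linarith⟩, concat_of_le hs'⟩
    · refine ⟨A + s, ⟨by linarith, by linarith⟩, ?_⟩
      rw [concat_of_ge hfg (by linarith)]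
      congr 1
      ring

theorem injOn_concat {f g : ℝ → X} {A B : ℝ} (hfg : f A = g 0)
    (hf : Set.InjOn f (Set.Icc 0 A)) (hg : Set.InjOn g (Set.Icc 0 B))
    (hd : f '' Set.Icc 0 A ∩ g '' Set.Icc 0 B ⊆ {f A}) :
    Set.InjOn (concat f g A) (Set.Icc 0 (A + B)) := by
  have key : ∀ s ∈ Set.Icc 0 (A + B), ∀ t ∈ Set.Icc 0 (A + B), s ≤ A → A < t →
      concat f g A s ≠ concat f g A t := by
    intro s hs t ht h h' he
    rw [concat_of_le h, concat_of_ge hfg h'.le] at he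
    have htB : t - A ∈ Set.Icc 0 B := ⟨by linarith, by linarith [ht.2]⟩
    have h1 := hd ⟨⟨s, ⟨hs.1, h⟩, rfl⟩, ⟨t - A, htB, he.symm⟩⟩
    rw [Set.mem_singleton_iff, he, hfg] at h1
    have := hg htB ⟨le_rfl, htB.1.trans htB.2⟩ h1
    linarith
  intro s hs t ht he
  rcases le_or_gt s A with h | h <;> rcases le_or_gt t A with h' | h'
  · rw [concat_of_le h, concat_of_le h'] at he
    exact hf ⟨hs.1, h⟩ ⟨ht.1, h'⟩ he
  · exact absurd he (key s hs t ht h h')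
  · exact absurd he.symm (key t ht s hs h' h)
  · rw [concat_of_ge hfg h.le, concat_of_ge hfg h'.le] at he
    have := hg ⟨by linarith, by linarith [hs.2]⟩ ⟨by linarith, by linarith [ht.2]⟩ he
    linarith

theorem image_sub_left_Icc (γ : ℝ → X) (L : ℝ) :
    (fun s => γ (L - s)) '' Set.Icc 0 L = γ '' Set.Icc 0 L := by
  ext p
  constructor <;> rintro ⟨r, hr, rfl⟩
  · exact ⟨L - r, ⟨by linarith [hr.2], by linarith [hr.1]⟩, rfl⟩
  · exact ⟨L - r, ⟨by linarith [hr.2], by linarith [hr.1]⟩, by simp⟩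

end Curves

/-! ### Geodesic segments in a metric space -/

section Metric

variable {X : Type*} [MetricSpace X]

/-- `γ` is parametrized by arc length on `[0, L]`. -/
def IsUnitSpeedGeodesic (γ : ℝ → X) (L : ℝ) : Prop :=
  ∀ s ∈ Set.Icc 0 L, ∀ t ∈ Set.Icc 0 L, dist (γ s) (γ t) = |s - t|

theorem continuousOn_concat {f g : ℝ → X} {A B : ℝ} (hA : 0 ≤ A) (hB : 0 ≤ B) (hfg : f A = g 0)
    (hf : ContinuousOn f (Set.Icc 0 A)) (hg : ContinuousOn g (Set.Icc 0 B)) :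
    ContinuousOn (concat f g A) (Set.Icc 0 (A + B)) := by
  rw [← Set.Icc_union_Icc_eq_Icc hA (show A ≤ A + B by linarith)]
  refine ContinuousOn.union_of_isClosed ?_ ?_ isClosed_Icc isClosed_Icc
  · exact hf.congr fun s hs => concat_of_le hs.2
  · have : ContinuousOn (fun s => g (s - A)) (Set.Icc A (A + B)) := by
      refine hg.comp (by fun_prop) fun s hs => ⟨by linarith [hs.1], by linarith [hs.2]⟩
    exact this.congr fun s hs => concat_of_ge hfg hs.1

/-- Two injective arcs with the same endpoints and otherwise disjoint form a simple closed curve. -/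
theorem isSimpleClosedCurve_union {f g : ℝ → X} {A B : ℝ} (hA : 0 < A) (hB : 0 ≤ B)
    (hfg : f A = g 0) (hgf : g B = f 0)
    (hfc : ContinuousOn f (Set.Icc 0 A)) (hgc : ContinuousOn g (Set.Icc 0 B))
    (hf : Set.InjOn f (Set.Icc 0 A)) (hg : Set.InjOn g (Set.Icc 0 B))
    (hd : f '' Set.Icc 0 A ∩ g '' Set.Icc 0 B ⊆ {f 0, f A}) :
    IsSimpleClosedCurve (f '' Set.Icc 0 A ∪ g '' Set.Icc 0 B) := by
  refine ⟨A + B, concat f g A, by linarith, continuousOn_concat hA.le hB hfg hfc hgc, ?_, ?_,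
    image_concat hA.le hB hfg⟩
  · rw [concat_of_le hA.le, concat_of_ge hfg (by linarith), add_sub_cancel_left, hgf]
  have key : ∀ s ∈ Set.Ico 0 (A + B), ∀ t ∈ Set.Ico 0 (A + B), s ≤ A → A < t →
      concat f g A s ≠ concat f g A t := by
    intro s hs t ht h h' he
    rw [concat_of_le h, concat_of_ge hfg h'.le] at he
    have htB : t - A ∈ Set.Icc 0 B := ⟨by linarith, by linarith [ht.2]⟩
    have h1 := hd ⟨⟨s, ⟨hs.1, h⟩, rfl⟩, ⟨t - A, htB, he.symm⟩⟩
    rcases h1 with h1 | h1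
    -- `g` reaches `f 0` only at its end `B`, that is at parameter `A + B`, which the half-open
    -- interval excludes.
    · rw [he, ← hgf] at h1
      have := hg htB ⟨hB, le_rfl⟩ h1
      linarith [ht.2]
    · rw [Set.mem_singleton_iff, he, hfg] at h1
      have := hg htB ⟨le_rfl, hB⟩ h1
      linarith
  intro s hs t ht he
  rcases le_or_gt s A with h | h <;> rcases le_or_gt t A with h' | h'
  · rw [concat_of_le h, concat_of_le h'] at he
    exact hf ⟨hs.1, h⟩ ⟨ht.1, h'⟩ he
  · exact absurd he (key s hs t ht h h')
  · exact absurd he.symm (key t ht s hs h' h)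
  · rw [concat_of_ge hfg h.le, concat_of_ge hfg h'.le] at he
    have := hg ⟨by linarith, by linarith [hs.2]⟩ ⟨by linarith, by linarith [ht.2]⟩ he
    linarith

namespace IsUnitSpeedGeodesic

variable {γ : ℝ → X} {L : ℝ}

theorem injOn (h : IsUnitSpeedGeodesic γ L) : Set.InjOn γ (Set.Icc 0 L) := by
  intro s hs t ht he
  have := h s hs t ht
  rw [he, dist_self, eq_comm, abs_eq_zero, sub_eq_zero] at this
  exact this

theorem continuousOn (h : IsUnitSpeedGeodesic γ L) : ContinuousOn γ (Set.Icc 0 L) := by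
  refine (LipschitzOnWith.of_dist_le_mul (K := 1) fun s hs t ht => ?_).continuousOn
  rw [h s hs t ht, Real.dist_eq]
  simp

theorem isGeodesicSegment (h : IsUnitSpeedGeodesic γ L) {s t : ℝ} (hs : 0 ≤ s) (hst : s ≤ t)
    (ht : t ≤ L) : IsGeodesicSegment (γ s) (γ t) (γ '' Set.Icc s t) := by
  have hd : dist (γ s) (γ t) = t - s := by
    rw [h s ⟨hs, hst.trans ht⟩ t ⟨hs.trans hst, ht⟩, abs_sub_comm, abs_of_nonneg (by linarith)]
  refine ⟨fun r => γ (s + r), by simp, by simp [hd], ?_, ?_⟩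
  · rw [hd]
    intro a ha b hb
    rw [h _ ⟨by linarith [ha.1], by linarith [ha.2]⟩ _ ⟨by linarith [hb.1], by linarith [hb.2]⟩]
    congr 1
    ring
  · rw [hd]
    ext p
    constructor
    · rintro ⟨r, hr, rfl⟩
      exact ⟨s + r, ⟨by linarith [hr.1], by linarith [hr.2]⟩, rfl⟩
    · rintro ⟨r, hr, rfl⟩
      exact ⟨r - s, ⟨by linarith [hr.1], by linarith [hr.2]⟩, by simp⟩

theorem reverse (h : IsUnitSpeedGeodesic γ L) : IsUnitSpeedGeodesic (fun s => γ (L - s)) L := by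
  intro s hs t ht
  rw [h _ ⟨by linarith [hs.2], by linarith [hs.1]⟩ _ ⟨by linarith [ht.2], by linarith [ht.1]⟩,
    abs_sub_comm]
  congr 1
  ring

end IsUnitSpeedGeodesic

namespace IsGeodesicSegment

variable {x y z : X} {R S : Set X}

theorem exists_param (h : IsGeodesicSegment x y S) : ∃ γ : ℝ → X, γ 0 = x ∧ γ (dist x y) = y ∧
    IsUnitSpeedGeodesic γ (dist x y) ∧ γ '' Set.Icc 0 (dist x y) = S := h

theorem symm (h : IsGeodesicSegment x y S) : IsGeodesicSegment y x S := by
  obtain ⟨γ, h0, h1, hγ, rfl⟩ := h.exists_param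
  rw [IsGeodesicSegment, dist_comm y x]
  exact ⟨fun s => γ (dist x y - s), by simpa, by simpa, hγ.reverse,
    image_sub_left_Icc γ _⟩

theorem refl (x : X) : IsGeodesicSegment x x {x} := by
  refine ⟨fun _ => x, rfl, rfl, ?_, ?_⟩
  · intro s hs t ht
    rw [dist_self] at *
    rw [Set.Icc_self, Set.mem_singleton_iff] at hs ht
    simp [hs, ht]
  · simp

theorem left_mem (h : IsGeodesicSegment x y S) : x ∈ S := by
  obtain ⟨γ, h0, h1, hγ, rfl⟩ := h
  exact ⟨0, ⟨le_rfl, dist_nonneg⟩, h0⟩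

theorem right_mem (h : IsGeodesicSegment x y S) : y ∈ S := h.symm.left_mem

theorem isCompact (h : IsGeodesicSegment x y S) : IsCompact S := by
  obtain ⟨γ, h0, h1, hγ, rfl⟩ := h.exists_param
  exact isCompact_Icc.image_of_continuousOn hγ.continuousOn

theorem isClosed (h : IsGeodesicSegment x y S) : IsClosed S := h.isCompact.isClosed

theorem isPreconnected (h : IsGeodesicSegment x y S) : IsPreconnected S := by
  obtain ⟨γ, h0, h1, hγ, rfl⟩ := h.exists_param
  exact isPreconnected_Icc.image _ hγ.continuousOn

/-- Any two points of a geodesic segment are joined by a part of it. -/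
theorem exists_subset (h : IsGeodesicSegment x y S) {p q : X} (hp : p ∈ S) (hq : q ∈ S) :
    ∃ R ⊆ S, IsGeodesicSegment p q R := by
  obtain ⟨γ, h0, h1, hγ, rfl⟩ := h.exists_param
  obtain ⟨s, hs, rfl⟩ := hp
  obtain ⟨t, ht, rfl⟩ := hq
  rcases le_total s t with hst | hst
  · exact ⟨_, Set.image_mono (Set.Icc_subset_Icc hs.1 ht.2),
      hγ.isGeodesicSegment hs.1 hst ht.2⟩
  · exact ⟨_, Set.image_mono (Set.Icc_subset_Icc ht.1 hs.2),
      (hγ.isGeodesicSegment ht.1 hst hs.2).symm⟩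

/-- A point of a geodesic segment is determined by its distance to an endpoint. -/
theorem eq_of_dist_eq (h : IsGeodesicSegment x y S) {p q : X} (hp : p ∈ S) (hq : q ∈ S)
    (hpq : dist x p = dist x q) : p = q := by
  obtain ⟨γ, rfl, h1, hγ, rfl⟩ := h.exists_param
  obtain ⟨s, hs, rfl⟩ := hp
  obtain ⟨t, ht, rfl⟩ := hq
  have h0 : (0 : ℝ) ∈ Set.Icc 0 (dist (γ 0) y) := ⟨le_rfl, dist_nonneg⟩
  rw [hγ 0 h0 s hs, hγ 0 h0 t ht, zero_sub, zero_sub, abs_neg, abs_neg, abs_of_nonneg hs.1,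
    abs_of_nonneg ht.1] at hpq
  rw [hpq]

theorem union (hR : IsGeodesicSegment x y R) (hS : IsGeodesicSegment y z S)
    (hd : dist x z = dist x y + dist y z) : IsGeodesicSegment x z (R ∪ S) := by
  obtain ⟨f, hf0, hf1, hf, rfl⟩ := hR.exists_param
  obtain ⟨g, hg0, hg1, hg, rfl⟩ := hS.exists_param
  have hA := dist_nonneg (x := x) (y := y)
  have hB := dist_nonneg (x := y) (y := z)
  have hfg : f (dist x y) = g 0 := by rw [hf1, hg0]
  -- The route through `y` gives the upper bound; anything shorter would be a shortcut from `x` to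
  -- `z`, against `hd`.
  have key : ∀ s ∈ Set.Icc 0 (dist x y), ∀ t ∈ Set.Icc 0 (dist y z),
      dist (f s) (g t) = dist x y - s + t := by
    intro s hs t ht
    have e1 := hf s hs _ ⟨hA, le_rfl⟩
    have e2 := hf 0 ⟨le_rfl, hA⟩ s hs
    have e3 := hg 0 ⟨le_rfl, hB⟩ t ht
    have e4 := hg t ht _ ⟨hB, le_rfl⟩
    rw [abs_sub_comm, abs_of_nonneg (by linarith [hs.2])] at e1
    rw [abs_sub_comm, abs_of_nonneg (by linarith [hs.1])] at e2
    rw [abs_sub_comm, abs_of_nonneg (by linarith [ht.1])] at e3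
    rw [abs_sub_comm, abs_of_nonneg (by linarith [ht.2])] at e4
    have t1 := dist_triangle (f s) (f (dist x y)) (g t)
    rw [hfg] at t1 e1
    have t2 := dist_triangle4 (f 0) (f s) (g t) (g (dist y z))
    rw [hf0, hg1] at t2
    rw [hg1] at e4
    rw [hf0] at e2
    linarith
  rw [IsGeodesicSegment, hd]
  refine ⟨concat f g (dist x y), ?_, ?_, ?_, image_concat hA hB hfg⟩
  · rw [concat_of_le hA, hf0]
  · rw [concat_of_ge hfg (by linarith), add_sub_cancel_left, hg1]
  intro s hs t ht
  rcases le_total s (dist x y) with h | h <;> rcases le_total t (dist x y) with h' | h'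
  · rw [concat_of_le h, concat_of_le h']
    exact hf s ⟨hs.1, h⟩ t ⟨ht.1, h'⟩
  · rw [concat_of_le h, concat_of_ge hfg h', key s ⟨hs.1, h⟩ _
      ⟨by linarith, by linarith [ht.2]⟩, abs_sub_comm, abs_of_nonneg (by linarith)]
    ring
  · rw [concat_of_le h', concat_of_ge hfg h, dist_comm, key t ⟨ht.1, h'⟩ _
      ⟨by linarith, by linarith [hs.2]⟩, abs_of_nonneg (by linarith)]
    ring
  · rw [concat_of_ge hfg h, concat_of_ge hfg h', hg _ ⟨by linarith, by linarith [hs.2]⟩ _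
      ⟨by linarith, by linarith [ht.2]⟩]
    congr 1
    ring

end IsGeodesicSegment

end Metric

/-! ### The metric graph: coordinates, distances, edge-saturated sets -/

section Graph

variable {V : Type*}

namespace MetricGraph

variable {G : SimpleGraph V} {hG : G.Connected}

/-! ### Coordinates -/

theorem add_le_one (x : MetricGraph G hG) {u v : V} (huv : u ≠ v) : x.1 u + x.1 v ≤ 1 := by
  by_cases hu : x.1 u = 0
  · linarith [x.le_one v]
  by_cases hv : x.1 v = 0
  · linarith [x.le_one u]
  exact (x.adj_of_ne_zero hu hv huv).2.le

theorem support_subset_pair (x : MetricGraph G hG) {u v : V} (huv : u ≠ v) (hu : x.1 u ≠ 0)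
    (hv : x.1 v ≠ 0) : x.1.support ⊆ {u, v} := by
  intro w hw
  by_contra hc
  simp only [Set.mem_insert_iff, Set.mem_singleton_iff, not_or] at hc
  have h1 := (x.adj_of_ne_zero hu hv huv).2
  have h2 := (x.adj_of_ne_zero hu hw (Ne.symm hc.1)).2
  have h3 := (x.adj_of_ne_zero hv hw (Ne.symm hc.2)).2
  have h4 : x.1 u = 1 / 2 := by linarith
  have h5 : x.1 v = 1 / 2 := by linarith
  have h6 : x.1 w = 1 / 2 := by linarith
  rcases x.cases_support with ⟨a, ha⟩ | ⟨a, b, hab, hs⟩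
  · have h7 : ∀ {c}, x.1 c ≠ 0 → c = a := fun {c} hc => by
      by_contra hne
      exact hc (x.eq_zero_of_eq_one ha hne)
    exact huv ((h7 hu).trans (h7 hv).symm)
  · have h1 := hs hu
    have h2 := hs hv
    have h3 := hs hw
    simp only [Set.mem_insert_iff, Set.mem_singleton_iff] at h1 h2 h3
    grind

theorem isVertex_or (x : MetricGraph G hG) :
    x.IsVertex ∨ ∃ u v, G.Adj u v ∧ x.1 u ≠ 0 ∧ x.1 v ≠ 0 := by
  rcases x.cases_support with h | ⟨u, v, huv, hs⟩
  · exact Or.inl h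
  · have := x.sum_eq_one huv.ne hs
    by_cases hu : x.1 u = 0
    · exact Or.inl ⟨v, by linarith⟩
    by_cases hv : x.1 v = 0
    · exact Or.inl ⟨u, by linarith⟩
    exact Or.inr ⟨u, v, huv, hu, hv⟩

/-- Barycentric coordinates are 1-Lipschitz. All the topology used later comes from this: the sets
where a coordinate is nonzero are open, and so is the interior of each edge. -/
theorem abs_sub_le_dist (x y : MetricGraph G hG) (w : V) : |x.1 w - y.1 w| ≤ dist x y := by
  rcases isPathLength_dist x y with ⟨u, v, huv, hx, hy, h1⟩ | ⟨u, v, hu, hv, h1⟩ <;> rw [h1]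
  · by_cases hwu : w = u
    · rw [hwu]
    by_cases hwv : w = v
    · have e1 := x.sum_eq_one huv.ne hx
      have e2 := y.sum_eq_one huv.ne hy
      rw [hwv, abs_sub_comm]
      apply le_of_eq
      congr 1
      linarith
    · have h0 : ∀ z : MetricGraph G hG, z.1.support ⊆ {u, v} → z.1 w = 0 := by
        intro z hz
        by_contra hc
        rcases hz hc with h | h
        · exact hwu h
        · exact hwv h
      rw [h0 x hx, h0 y hy]
      simp
  · have e1 := x.nonneg w
    have e2 := x.le_one w
    have e3 := y.nonneg w
    have e4 := y.le_one w
    have e5 := x.le_one u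
    have e6 := y.le_one v
    rcases eq_or_ne u v with rfl | huv
    · rw [SimpleGraph.dist_self, abs_le]
      rcases eq_or_ne w u with rfl | hw
      · constructor <;> push_cast <;> linarith
      · have e7 := x.add_le_one hw
        have e8 := y.add_le_one hw
        constructor <;> push_cast <;> linarith
    · have : 1 ≤ G.dist u v := hG.pos_dist_of_ne huv
      have : (1 : ℝ) ≤ G.dist u v := by exact_mod_cast this
      rw [abs_le]
      constructor <;> linarith

theorem continuous_coord (w : V) : Continuous fun x : MetricGraph G hG => x.1 w := by
  refine (LipschitzWith.of_dist_le_mul (K := 1) fun x y => ?_).continuous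
  rw [Real.dist_eq, NNReal.coe_one, one_mul]
  exact abs_sub_le_dist x y w

theorem isOpen_coord_ne_zero (w : V) : IsOpen {x : MetricGraph G hG | x.1 w ≠ 0} :=
  isOpen_ne_fun (continuous_coord w) continuous_const

theorem dist_eq_abs {x y : MetricGraph G hG} {u v : V} (huv : G.Adj u v)
    (hx : x.1.support ⊆ {u, v}) (hy : y.1.support ⊆ {u, v}) : dist x y = |x.1 u - y.1 u| :=
  le_antisymm (dist_le (Or.inl ⟨u, v, huv, hx, hy, rfl⟩)) (abs_sub_le_dist x y u)

/-- The points of the edge `[u, v]`. -/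
def edgeSet (G : SimpleGraph V) (hG : G.Connected) (u v : V) : Set (MetricGraph G hG) :=
  {x | x.1.support ⊆ {u, v}}

theorem mem_edgeSet {u v : V} {x : MetricGraph G hG} :
    x ∈ edgeSet G hG u v ↔ x.1.support ⊆ {u, v} := Iff.rfl

open Classical in
/-- The vertex `v` as a point of the metric graph. -/
noncomputable def vtx (G : SimpleGraph V) (hG : G.Connected) (v : V) : MetricGraph G hG :=
  ⟨Pi.single v 1, v, v, 0, Or.inl rfl, by simp, by simp⟩

theorem vtx_self (v : V) : (vtx G hG v).1 v = 1 := by simp [vtx]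

theorem vtx_of_ne {u v : V} (h : u ≠ v) : (vtx G hG v).1 u = 0 := by simp [vtx, h]

theorem vtx_ne_zero {u v : V} : (vtx G hG v).1 u ≠ 0 ↔ u = v := by
  constructor
  · intro h
    by_contra hne
    exact h (vtx_of_ne hne)
  · rintro rfl
    simp [vtx_self]

theorem support_vtx (v : V) : (vtx G hG v).1.support = {v} := by
  ext w
  simp [vtx_ne_zero]

theorem eq_vtx {x : MetricGraph G hG} {v : V} (h : x.1 v = 1) : x = vtx G hG v := by
  refine Subtype.ext (funext fun w => ?_)
  by_cases hw : w = v
  · rw [hw, h, vtx_self]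
  · rw [x.eq_zero_of_eq_one h hw, vtx_of_ne hw]

theorem isVertex_vtx (v : V) : (vtx G hG v).IsVertex := ⟨v, vtx_self v⟩

theorem isVertex_iff {x : MetricGraph G hG} : x.IsVertex ↔ ∃ v, x = vtx G hG v :=
  ⟨fun ⟨v, hv⟩ => ⟨v, eq_vtx hv⟩, fun ⟨v, hv⟩ => hv ▸ isVertex_vtx v⟩

theorem IsVertex.not_adj {x : MetricGraph G hG} (h : x.IsVertex) {u v : V} (huv : u ≠ v)
    (hu : x.1 u ≠ 0) (hv : x.1 v ≠ 0) : False := by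
  obtain ⟨w, rfl⟩ := isVertex_iff.mp h
  exact huv ((vtx_ne_zero.mp hu).trans (vtx_ne_zero.mp hv).symm)

theorem isOpen_not_isVertex : IsOpen {x : MetricGraph G hG | ¬ x.IsVertex} := by
  rw [isOpen_iff_mem_nhds]
  intro x hx
  obtain ⟨u, v, huv, hu, hv⟩ := x.isVertex_or.resolve_left hx
  filter_upwards [(isOpen_coord_ne_zero u).mem_nhds hu, (isOpen_coord_ne_zero v).mem_nhds hv]
    with y hyu hyv h
  exact h.not_adj huv.ne hyu hyv

theorem isClosed_isVertex : IsClosed {x : MetricGraph G hG | x.IsVertex} :=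
  ⟨isOpen_not_isVertex⟩

theorem vtx_left_mem_edgeSet (u v : V) : vtx G hG u ∈ edgeSet G hG u v := by
  rw [mem_edgeSet, support_vtx]
  simp

theorem vtx_right_mem_edgeSet (u v : V) : vtx G hG v ∈ edgeSet G hG u v := by
  rw [mem_edgeSet, support_vtx]
  simp

/-! ### Distances -/

/-- A shortest path from a point to a vertex starts with the way to an endpoint of the edge. -/
theorem exists_dist_vtx (x : MetricGraph G hG) (w : V) :
    ∃ u, x.1 u ≠ 0 ∧ dist x (vtx G hG w) = (1 - x.1 u) + G.dist u w := by
  have key : ∀ v, G.Adj w v → x.1.support ⊆ {w, v} → dist x (vtx G hG w) = 1 - x.1 w →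
      ∃ u, x.1 u ≠ 0 ∧ dist x (vtx G hG w) = (1 - x.1 u) + G.dist u w := by
    intro v hwv hs hd
    have h1 := x.sum_eq_one hwv.ne hs
    by_cases h0 : x.1 w = 0
    · refine ⟨v, by rw [h0, zero_add] at h1; simp [h1], ?_⟩
      rw [hd, SimpleGraph.dist_eq_one_iff_adj.mpr hwv.symm]
      push_cast
      linarith
    · exact ⟨w, h0, by simp [hd]⟩
  rcases isPathLength_dist x (vtx G hG w) with ⟨u, v, huv, hx, hy, h1⟩ | ⟨u, v, hu, hv, h1⟩
  · rcases hy (vtx_ne_zero.mpr (rfl : w = w)) with rfl | h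
    · refine key v huv hx ?_
      rw [h1, vtx_self, abs_sub_comm, abs_of_nonneg (by linarith [x.le_one w])]
    · obtain rfl : w = v := h
      have h2 := x.sum_eq_one huv.ne hx
      refine key u huv.symm (by rwa [Set.pair_comm]) ?_
      rw [h1, vtx_of_ne huv.ne, sub_zero, abs_of_nonneg (x.nonneg u)]
      linarith
  · obtain rfl := vtx_ne_zero.mp hv
    refine ⟨u, hu, ?_⟩
    rw [h1, vtx_self, sub_self, add_zero]

theorem dist_vtx_le (x : MetricGraph G hG) {u : V} (hu : x.1 u ≠ 0) (w : V) :
    dist x (vtx G hG w) ≤ (1 - x.1 u) + G.dist u w := by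
  refine (dist_le (Or.inr ⟨u, w, hu, vtx_ne_zero.mpr rfl, rfl⟩)).trans ?_
  simp [vtx_self]

theorem dist_vtx_of_ne_zero (x : MetricGraph G hG) {u : V} (hu : x.1 u ≠ 0) :
    dist x (vtx G hG u) = 1 - x.1 u := by
  refine le_antisymm (by simpa using x.dist_vtx_le hu u) ?_
  have := neg_le_of_abs_le (abs_sub_le_dist x (vtx G hG u) u)
  rw [vtx_self] at this
  linarith

theorem dist_vtx_vtx (u v : V) : dist (vtx G hG u) (vtx G hG v) = G.dist u v := by
  obtain ⟨w, hw, h⟩ := exists_dist_vtx (vtx G hG u) v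
  obtain rfl := vtx_ne_zero.mp hw
  rw [h, vtx_self]
  ring

theorem vtx_injective : Function.Injective (vtx G hG) := fun u v h =>
  vtx_ne_zero.mp (h ▸ vtx_ne_zero.mpr rfl : (vtx G hG v).1 u ≠ 0)

theorem coord_of_dist_lt_one {x : MetricGraph G hG} {u : V} (h : dist x (vtx G hG u) < 1) :
    x.1 u = 1 - dist x (vtx G hG u) ∧ x.1 u ≠ 0 := by
  have := abs_sub_le_dist x (vtx G hG u) u
  rw [vtx_self] at this
  have h0 : x.1 u ≠ 0 := by
    intro h0
    rw [h0] at this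
    norm_num at this
    linarith
  exact ⟨by linarith [x.dist_vtx_of_ne_zero h0], h0⟩

/-- The distance is `(1 - x u) + G.dist u w` with `0 < x u ≤ 1`, so `1 - x u` is its fractional part
and vanishes. -/
theorem isVertex_of_dist_eq_natCast {x : MetricGraph G hG} {w : V} {n : ℕ}
    (h : dist x (vtx G hG w) = n) : x.IsVertex := by
  obtain ⟨u, hu, h1⟩ := x.exists_dist_vtx w
  refine ⟨u, ?_⟩
  have h2 : (n : ℝ) < G.dist u w + 1 := by
    have := (x.nonneg u).lt_of_ne' hu
    linarith
  have h3 : (G.dist u w : ℝ) ≤ n := by linarith [x.le_one u]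
  have h4 : n = G.dist u w := by
    have h2' : n < G.dist u w + 1 := by exact_mod_cast h2
    have h3' : G.dist u w ≤ n := by exact_mod_cast h3
    omega
  rw [h4] at h
  linarith

/-! ### Geodesics -/

open Classical in
/-- The point `(1 - t) u + t v` of the edge `[u, v]`. -/
noncomputable def edgePoint (hG : G.Connected) {u v : V} (h : G.Adj u v) (t : ℝ)
    (ht : t ∈ Set.Icc (0 : ℝ) 1) : MetricGraph G hG :=
  ⟨(1 - t) • Pi.single u (1 : ℝ) + t • Pi.single v (1 : ℝ), u, v, t, Or.inr h, ht, rfl⟩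

theorem edgePoint_left {u v : V} (h : G.Adj u v) {t : ℝ} (ht : t ∈ Set.Icc (0 : ℝ) 1) :
    (edgePoint hG h t ht).1 u = 1 - t := by
  simp [edgePoint, h.ne]

theorem edgePoint_mem {u v : V} (h : G.Adj u v) {t : ℝ} (ht : t ∈ Set.Icc (0 : ℝ) 1) :
    edgePoint hG h t ht ∈ edgeSet G hG u v := by
  intro w hw
  by_contra hc
  simp only [Set.mem_insert_iff, Set.mem_singleton_iff, not_or] at hc
  exact hw (by simp [edgePoint, hc.1, hc.2])

theorem isGeodesicSegment_edgeSet {u v : V} (h : G.Adj u v) :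
    IsGeodesicSegment (vtx G hG u) (vtx G hG v) (edgeSet G hG u v) := by
  have hd : dist (vtx G hG u) (vtx G hG v) = 1 := by
    rw [dist_vtx_vtx, SimpleGraph.dist_eq_one_iff_adj.mpr h, Nat.cast_one]
  have hc : ∀ t ∈ Set.Icc (0 : ℝ) 1, (Set.projIcc (0 : ℝ) 1 zero_le_one t : ℝ) = t :=
    fun t ht => by rw [Set.projIcc_of_mem zero_le_one ht]
  rw [IsGeodesicSegment, hd]
  -- `edgePoint` is defined only for parameters in `[0, 1]`; clamping makes the curve total on `ℝ`.
  refine ⟨fun t => edgePoint hG h _ (Set.projIcc (0 : ℝ) 1 zero_le_one t).2, ?_, ?_, ?_, ?_⟩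
  · refine ext_of_support h.ne (edgePoint_mem h _) (vtx_left_mem_edgeSet u v) ?_
    rw [edgePoint_left, vtx_self, hc 0 (by simp), sub_zero]
  · refine ext_of_support h.ne (edgePoint_mem h _) (vtx_right_mem_edgeSet u v) ?_
    rw [edgePoint_left, vtx_of_ne h.ne, hc 1 (by simp), sub_self]
  · intro s hs t ht
    rw [dist_eq_abs h (edgePoint_mem h _) (edgePoint_mem h _), edgePoint_left, edgePoint_left,
      hc s hs, hc t ht, abs_sub_comm]
    congr 1
    ring
  · ext x
    constructor
    · rintro ⟨t, ht, rfl⟩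
      exact edgePoint_mem h _
    · intro hx
      have ht : 1 - x.1 u ∈ Set.Icc (0 : ℝ) 1 :=
        ⟨by linarith [x.le_one u], by linarith [x.nonneg u]⟩
      refine ⟨1 - x.1 u, ht, ext_of_support h.ne (edgePoint_mem h _) hx ?_⟩
      rw [edgePoint_left, hc _ ht]
      ring

theorem exists_adj_dist_eq (hG : G.Connected) {u w : V} (h : u ≠ w) :
    ∃ v, G.Adj u v ∧ G.dist u w = G.dist v w + 1 := by
  obtain ⟨p, hp⟩ := hG.exists_walk_length_eq_dist u w
  cases p with
  | nil => exact absurd rfl h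
  | @cons _ v _ hadj q =>
    refine ⟨v, hadj, ?_⟩
    rw [SimpleGraph.Walk.length_cons] at hp
    have h1 := SimpleGraph.dist_le q
    have h2 := SimpleGraph.dist_eq_one_iff_adj.mpr hadj
    have h3 := hG.dist_triangle (u := u) (v := v) (w := w)
    omega

/-- A geodesic from a neighbour closer to the target can be extended. -/
theorem isGeodesicSegment_edgeSet_union {u v w : V} (h : G.Adj u v)
    (hd : G.dist u w = G.dist v w + 1) {S : Set (MetricGraph G hG)}
    (hS : IsGeodesicSegment (vtx G hG v) (vtx G hG w) S) :
    IsGeodesicSegment (vtx G hG u) (vtx G hG w) (edgeSet G hG u v ∪ S) := by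
  refine (isGeodesicSegment_edgeSet h).union hS ?_
  rw [dist_vtx_vtx, dist_vtx_vtx, dist_vtx_vtx, hd, SimpleGraph.dist_eq_one_iff_adj.mpr h]
  push_cast
  ring

theorem exists_isGeodesicSegment (hG : G.Connected) (u w : V) :
    ∃ S, IsGeodesicSegment (vtx G hG u) (vtx G hG w) S := by
  induction hn : G.dist u w generalizing u with
  | zero =>
    obtain rfl := hG.dist_eq_zero_iff.mp hn
    exact ⟨_, IsGeodesicSegment.refl _⟩
  | succ n ih =>
    have hne : u ≠ w := by
      rintro rfl
      simp at hn
    obtain ⟨v, hadj, hd⟩ := exists_adj_dist_eq hG hne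
    obtain ⟨S, hS⟩ := ih v (by omega)
    exact ⟨_, isGeodesicSegment_edgeSet_union hadj hd hS⟩

/-- A set which, with an interior point of an edge, contains the whole edge. -/
def EdgeSaturated (S : Set (MetricGraph G hG)) : Prop :=
  ∀ p ∈ S, ∀ u v, u ≠ v → p.1 u ≠ 0 → p.1 v ≠ 0 → edgeSet G hG u v ⊆ S

namespace EdgeSaturated

variable {R S : Set (MetricGraph G hG)}

theorem union (hR : EdgeSaturated R) (hS : EdgeSaturated S) : EdgeSaturated (R ∪ S) := by
  rintro p (hp | hp) u v huv hu hv
  · exact (hR p hp u v huv hu hv).trans Set.subset_union_left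
  · exact (hS p hp u v huv hu hv).trans Set.subset_union_right

/-- Used in contrapositive form: a frontier point belonging to an edge-saturated set is a vertex. -/
theorem mem_nhds (hS : EdgeSaturated S) {p : MetricGraph G hG} (hp : p ∈ S)
    (hv : ¬ p.IsVertex) : S ∈ nhds p := by
  obtain ⟨u, v, huv, hu, hv⟩ := p.isVertex_or.resolve_left hv
  filter_upwards [(isOpen_coord_ne_zero u).mem_nhds hu, (isOpen_coord_ne_zero v).mem_nhds hv]
    with y hyu hyv
  exact hS p hp u v huv.ne hu hv (y.support_subset_pair huv.ne hyu hyv)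

end EdgeSaturated

/-- In a geodesic starting at a vertex the points at integer distance are vertices. -/
theorem isVertex_of_param {a : V} {L : ℝ} {γ : ℝ → MetricGraph G hG} (h0 : γ 0 = vtx G hG a)
    (hγ : IsUnitSpeedGeodesic γ L) {n : ℕ} (hn : (n : ℝ) ≤ L) : (γ n).IsVertex := by
  refine isVertex_of_dist_eq_natCast (w := a) (n := n) ?_
  rw [← h0, hγ n ⟨by positivity, hn⟩ 0 ⟨le_rfl, le_trans (by positivity) hn⟩, sub_zero,
    abs_of_nonneg (by positivity)]

/-- The points of a geodesic between vertices other than vertices. -/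
theorem exists_edge_of_param {a b : V} {γ : ℝ → MetricGraph G hG} (h0 : γ 0 = vtx G hG a)
    (hγ : IsUnitSpeedGeodesic γ (G.dist a b)) {s : ℝ} (hs : s ∈ Set.Icc (0 : ℝ) (G.dist a b))
    (hv : ¬ (γ s).IsVertex) : ∃ (i : ℕ) (u v : V), G.Adj u v ∧ (i : ℝ) < s ∧ s < i + 1 ∧
      (i : ℝ) + 1 ≤ G.dist a b ∧ γ i = vtx G hG u ∧ γ (i + 1) = vtx G hG v ∧
      (γ s).1 u = 1 - (s - i) ∧ (γ s).1 v = s - i := by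
  have hi0 : (⌊s⌋₊ : ℝ) ≤ s := Nat.floor_le hs.1
  have hi1 : s < ⌊s⌋₊ + 1 := Nat.lt_floor_add_one s
  generalize ⌊s⌋₊ = i at hi0 hi1
  have hlt : (i : ℝ) < s := by
    refine lt_of_le_of_ne hi0 fun h => hv ?_
    rw [← h]
    exact isVertex_of_param h0 hγ (h.le.trans hs.2)
  have hle : i + 1 ≤ G.dist a b := by
    have : (i : ℝ) < G.dist a b := hlt.trans_le hs.2
    exact_mod_cast this
  have hle' : (i : ℝ) + 1 ≤ G.dist a b := by exact_mod_cast hle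
  have hi : (i : ℝ) ∈ Set.Icc (0 : ℝ) (G.dist a b) := ⟨by positivity, by linarith⟩
  have hi' : (i : ℝ) + 1 ∈ Set.Icc (0 : ℝ) (G.dist a b) := ⟨by positivity, hle'⟩
  obtain ⟨u, hu⟩ := isVertex_iff.mp (isVertex_of_param h0 hγ hi.2)
  obtain ⟨v, hv⟩ := isVertex_iff.mp (isVertex_of_param h0 hγ (n := i + 1) (by exact_mod_cast hle))
  push_cast at hv
  have hadj : G.Adj u v := by
    rw [← SimpleGraph.dist_eq_one_iff_adj]
    have := hγ _ hi _ hi'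
    rw [hu, hv, dist_vtx_vtx] at this
    have h1 : (G.dist u v : ℝ) = 1 := by simpa using this
    exact_mod_cast h1
  refine ⟨i, u, v, hadj, hlt, hi1, hle', hu, hv, ?_, ?_⟩
  · have := hγ _ hs _ hi
    rw [abs_of_nonneg (by linarith), hu] at this
    rw [(coord_of_dist_lt_one (by linarith)).1, this]
  · have := hγ _ hs _ hi'
    rw [abs_sub_comm, abs_of_nonneg (by linarith), hv] at this
    rw [(coord_of_dist_lt_one (by linarith)).1, this]
    ring

/-- At integer times the geodesic is at vertices, consecutive ones being adjacent, so it crosses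
edges from end to end. -/
theorem edgeSaturated {a b : V} {S : Set (MetricGraph G hG)}
    (hS : IsGeodesicSegment (vtx G hG a) (vtx G hG b) S) : EdgeSaturated S := by
  obtain ⟨γ, h0, h1, hγ, rfl⟩ := hS.exists_param
  rw [dist_vtx_vtx] at *
  rintro p ⟨s, hs, rfl⟩ u v huv hu hv q hq
  obtain ⟨i, u', v', hadj, hi0, hi1, hi2, hu', hv', cu, cv⟩ :=
    exists_edge_of_param h0 hγ hs fun h => h.not_adj huv hu hv
  have hpair : ({u, v} : Set V) = {u', v'} := by
    have h := (γ s).support_subset_pair hadj.ne (by rw [cu]; linarith) (by rw [cv]; linarith)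
    have h2 := h hu
    have h3 := h hv
    simp only [Set.mem_insert_iff, Set.mem_singleton_iff] at h2 h3
    rcases h2 with rfl | rfl <;> rcases h3 with rfl | rfl
    · exact absurd rfl huv
    · rfl
    · exact Set.pair_comm _ _
    · exact absurd rfl huv
  have hq' : q ∈ edgeSet G hG u' v' := by
    rw [mem_edgeSet, ← hpair]
    exact hq
  have hsum := q.sum_eq_one hadj.ne hq'
  have q0 := q.nonneg u'
  have q1 := q.nonneg v'
  have hr : (i : ℝ) + q.1 v' ∈ Set.Icc (0 : ℝ) (G.dist a b) := ⟨by positivity, by linarith⟩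
  -- The coordinate `q v'` is the distance from `u'`, hence the time elapsed since `i`. For an
  -- interior `q`, the point of the geodesic at this time is within distance less than 1 of both
  -- ends, which places it on the same edge.
  refine ⟨i + q.1 v', hr, ?_⟩
  rcases q0.eq_or_lt with q0 | q0
  · rw [show q.1 v' = 1 by linarith, hv', eq_vtx (show q.1 v' = 1 by linarith)]
  rcases q1.eq_or_lt with q1 | q1
  · rw [← q1, add_zero, hu', eq_vtx (show q.1 u' = 1 by linarith)]
  have e1 := hγ _ hr i ⟨by positivity, by linarith⟩
  have e2 := hγ _ hr (i + 1) ⟨by positivity, by linarith⟩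
  rw [hu', add_sub_cancel_left, abs_of_pos q1] at e1
  rw [hv', abs_sub_comm, abs_of_nonneg (by linarith)] at e2
  have c1 := coord_of_dist_lt_one (e1.trans_lt (by linarith))
  have c2 := coord_of_dist_lt_one (e2.trans_lt (by linarith))
  refine ext_of_support hadj.ne (support_subset_pair _ hadj.ne c1.2 c2.2) hq' ?_
  rw [c1.1, e1]
  linarith

end MetricGraph

end Graph

/-! ### Thinness as a bound on distances -/

section Metric

variable {X : Type*} [MetricSpace X]

namespace GeodesicTriangle

/-- The triangle with the vertices and sides permuted cyclically. -/
def rotate (T : GeodesicTriangle X) : GeodesicTriangle X :=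
  ⟨T.y, T.z, T.x, T.yz, T.zx, T.xy, T.isGeodesic_yz, T.isGeodesic_zx, T.isGeodesic_xy⟩

theorem carrier_rotate (T : GeodesicTriangle X) : T.rotate.carrier = T.carrier := by
  simp only [carrier, rotate]
  rw [Set.union_comm, ← Set.union_assoc]

/-- With thinness in this form, estimates are needed only for the side `[xy]`; `rotate` carries them
to the other two sides. -/
theorem isThin_iff (T : GeodesicTriangle X) (δ : ℝ≥0) : T.IsThin δ ↔
    (∀ p ∈ T.xy, Metric.infEDist p (T.yz ∪ T.zx) ≤ δ) ∧
    (∀ p ∈ T.yz, Metric.infEDist p (T.zx ∪ T.xy) ≤ δ) ∧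
    (∀ p ∈ T.zx, Metric.infEDist p (T.xy ∪ T.yz) ≤ δ) := by
  simp only [IsThin, Set.subset_def, Metric.mem_cthickening_iff, ENNReal.ofReal_coe_nnreal]

theorem infEDist_le_thinConst (T : GeodesicTriangle X) {p : X} (hp : p ∈ T.xy) :
    Metric.infEDist p (T.yz ∪ T.zx) ≤ T.thinConst :=
  le_iInf₂ fun δ hδ => ((T.isThin_iff δ).mp hδ).1 p hp

theorem thinConst_rotate (T : GeodesicTriangle X) : T.rotate.thinConst = T.thinConst := by
  have : ∀ δ : ℝ≥0, T.rotate.IsThin δ ↔ T.IsThin δ := fun δ =>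
    ⟨fun ⟨h1, h2, h3⟩ => ⟨h3, h1, h2⟩, fun ⟨h1, h2, h3⟩ => ⟨h2, h3, h1⟩⟩
  simp only [thinConst, this]

/-- Thinness consists of non-strict inequalities, so the infimum defining the thin constant is
itself admissible. -/
theorem isThin_of_thinConst_le {T : GeodesicTriangle X} {δ : ℝ≥0} (h : T.thinConst ≤ δ) :
    T.IsThin δ := by
  rw [isThin_iff]
  refine ⟨fun p hp => (T.infEDist_le_thinConst hp).trans h, fun p hp => ?_, fun p hp => ?_⟩
  · exact (T.rotate.infEDist_le_thinConst hp).trans (T.thinConst_rotate.le.trans h)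
  · exact (T.rotate.rotate.infEDist_le_thinConst hp).trans
      ((T.rotate.thinConst_rotate.trans T.thinConst_rotate).le.trans h)

theorem thinConst_le {T : GeodesicTriangle X} {δ : ℝ≥0} (h : T.IsThin δ) : T.thinConst ≤ δ :=
  iInf₂_le δ h

end GeodesicTriangle

theorem infEDist_le_add {S R : Set X} {p : X} {a b : ℝ≥0∞} (hR : IsCompact R) (hR' : R.Nonempty)
    (hp : Metric.infEDist p R ≤ a) (h : ∀ q ∈ R, Metric.infEDist q S ≤ b) :
    Metric.infEDist p S ≤ a + b := by
  obtain ⟨q, hq, he⟩ := hR.exists_infEDist_eq_edist hR' p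
  calc Metric.infEDist p S ≤ edist p q + Metric.infEDist q S :=
        Metric.infEDist_le_edist_add_infEDist
    _ ≤ a + b := add_le_add (he ▸ hp) (h q hq)

end Metric

/-! ### From cycles to all triangles with corners in `V` -/

section Graph

variable {V : Type*}

namespace MetricGraph

variable {G : SimpleGraph V} {hG : G.Connected}

theorem rotate_mem_vertexTriangles {T : GeodesicTriangle (MetricGraph G hG)}
    (h : T ∈ vertexTriangles G hG) : T.rotate ∈ vertexTriangles G hG := by
  obtain ⟨hc, hx, hy, hz⟩ := h
  refine ⟨?_, hy, hz, hx⟩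
  rw [GeodesicTriangle.IsCycle, T.carrier_rotate]
  exact hc

theorem infEDist_le_vertexHypConst {T : GeodesicTriangle (MetricGraph G hG)}
    (h : T ∈ vertexTriangles G hG) {p : MetricGraph G hG} (hp : p ∈ T.xy) :
    Metric.infEDist p (T.yz ∪ T.zx) ≤ vertexHypConst G hG :=
  le_iInf₂ fun δ hδ => ((T.isThin_iff δ).mp (hδ T h)).1 p hp

/-- Two geodesics issuing from the endpoints of a third one, which they do not meet elsewhere,
to a common endpoint contain two sides of a cycle. -/
theorem exists_mem_vertexTriangles {a b z : V} (hab : a ≠ b) {α β γ : Set (MetricGraph G hG)}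
    (hα : IsGeodesicSegment (vtx G hG a) (vtx G hG b) α)
    (hβ : IsGeodesicSegment (vtx G hG b) (vtx G hG z) β)
    (hγ : IsGeodesicSegment (vtx G hG a) (vtx G hG z) γ)
    (hd : α ∩ (β ∪ γ) ⊆ {vtx G hG a, vtx G hG b}) :
    ∃ T ∈ vertexTriangles G hG, T.xy = α ∧ T.yz ⊆ β ∧ T.zx ⊆ γ := by
  obtain ⟨g, g0, g1, hg, rfl⟩ := hγ.exists_param
  generalize dist (vtx G hG a) (vtx G hG z) = L at *
  have hL : 0 ≤ L := by
    by_contra hL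
    have := hγ.left_mem
    rw [Set.Icc_eq_empty hL] at this
    simp at this
  -- Let `t` be the first time at which `γ`, run from `a`, hits `β`. Then `γ` up to `t` and the part
  -- of `β` from `b` to `g t` meet only at `g t`.
  have hK : IsCompact (Set.Icc 0 L ∩ g ⁻¹' β) :=
    isCompact_Icc.of_isClosed_subset
      (hg.continuousOn.preimage_isClosed_of_isClosed isClosed_Icc hβ.isClosed)
      Set.inter_subset_left
  obtain ⟨t, ⟨ht, htβ⟩, hmin⟩ := hK.exists_isLeast
    ⟨L, ⟨hL, le_rfl⟩, by rw [Set.mem_preimage, g1]; exact hβ.right_mem⟩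
  rw [Set.mem_preimage] at htβ
  -- Otherwise `β` would be a neighbourhood of `g t`, and `γ` would already be in `β` just before
  -- `t`.
  have hvert : (g t).IsVertex := by
    by_contra hv
    have hn := (edgeSaturated hβ).mem_nhds htβ hv
    have ht0 : 0 < t := by
      refine lt_of_le_of_ne ht.1 ?_
      rintro rfl
      rw [g0] at hv
      exact hv (isVertex_vtx a)
    have hc := (hg.continuousOn t ht).preimage_mem_nhdsWithin hn
    have hIoo : Set.Ioo 0 t ⊆ Set.Icc 0 L := fun r hr => ⟨hr.1.le, hr.2.le.trans ht.2⟩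
    have hc' := nhdsWithin_mono t hIoo hc
    have : (nhdsWithin t (Set.Ioo 0 t)).NeBot := by
      rw [nhdsWithin_Ioo_eq_nhdsLT ht0]
      infer_instance
    obtain ⟨r, hr, hr'⟩ := Filter.nonempty_of_mem (Filter.inter_mem hc' self_mem_nhdsWithin)
    have := hmin ⟨hIoo hr', hr⟩
    linarith [hr'.2]
  obtain ⟨c, hc⟩ := isVertex_iff.mp hvert
  have hγ' : IsGeodesicSegment (vtx G hG c) (vtx G hG a) (g '' Set.Icc 0 t) := by
    rw [← hc, ← g0]
    exact (hg.isGeodesicSegment le_rfl ht.1 ht.2).symm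
  obtain ⟨β', hββ', hβ'⟩ := hβ.exists_subset hβ.left_mem htβ
  rw [hc] at hβ'
  have hsub : g '' Set.Icc 0 t ⊆ g '' Set.Icc 0 L :=
    Set.image_mono (Set.Icc_subset_Icc le_rfl ht.2)
  refine ⟨⟨_, _, _, α, β', g '' Set.Icc 0 t, hα, hβ', hγ'⟩,
    ⟨?_, isVertex_vtx _, isVertex_vtx _, isVertex_vtx _⟩, rfl, hββ', hsub⟩
  have hmeet : ∀ q, q ∈ β' → q ∈ g '' Set.Icc 0 t → q = vtx G hG c := by
    rintro q hq ⟨r, hr, rfl⟩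
    have : t ≤ r := hmin ⟨⟨hr.1, hr.2.trans ht.2⟩, hββ' hq⟩
    rw [← hc, le_antisymm hr.2 this]
  have hsub2 : β' ∪ g '' Set.Icc 0 t ⊆ β ∪ g '' Set.Icc 0 L := Set.union_subset_union hββ' hsub
  rw [GeodesicTriangle.IsCycle, GeodesicTriangle.carrier]
  dsimp only
  clear hsub hγ hmin hK g0 g1
  obtain ⟨f, f0, f1, hf, rfl⟩ := hα.exists_param
  obtain ⟨k, k0, k1, hk, rfl⟩ := hβ'.exists_param
  obtain ⟨l, l0, l1, hl, hle⟩ := hγ'.exists_param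
  rw [← hle] at hmeet hsub2 ⊢
  have hkl : k (dist (vtx G hG b) (vtx G hG c)) = l 0 := k1.trans l0.symm
  -- The cycle consists of `α` and one return arc from `b` to `a`: `β'` followed by the reversed
  -- start of `γ`.
  rw [Set.union_assoc, ← image_concat dist_nonneg dist_nonneg hkl] at *
  refine isSimpleClosedCurve_union (dist_pos.mpr (vtx_injective.ne hab))
    (add_nonneg dist_nonneg dist_nonneg) ?_ ?_ hf.continuousOn
    (continuousOn_concat dist_nonneg dist_nonneg hkl hk.continuousOn hl.continuousOn)
    hf.injOn (injOn_concat hkl hk.injOn hl.injOn ?_) ?_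
  · rw [concat_of_le dist_nonneg, f1, k0]
  · rw [concat_of_ge hkl (le_add_of_nonneg_right dist_nonneg), add_sub_cancel_left, l1, f0]
  · rintro q ⟨h1, h2⟩
    rw [k1]
    exact hmeet q h1 h2
  · rw [f0, f1]
    exact (Set.inter_subset_inter_right _ hsub2).trans hd

/-- The cycle through `α` has its other sides inside `β ∪ γ`, and passing to the larger set only
decreases distances. If `a = b`, the segment `α` is a point of `β`. -/
theorem infEDist_le_of_segments {a b z : V} {α β γ : Set (MetricGraph G hG)}
    (hα : IsGeodesicSegment (vtx G hG a) (vtx G hG b) α)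
    (hβ : IsGeodesicSegment (vtx G hG b) (vtx G hG z) β)
    (hγ : IsGeodesicSegment (vtx G hG a) (vtx G hG z) γ)
    (hd : α ∩ (β ∪ γ) ⊆ {vtx G hG a, vtx G hG b}) {p : MetricGraph G hG} (hp : p ∈ α) :
    Metric.infEDist p (β ∪ γ) ≤ vertexHypConst G hG := by
  rcases eq_or_ne a b with rfl | hab
  · have := hα.eq_of_dist_eq hp hα.left_mem
      (by
        obtain ⟨f, f0, f1, hf, rfl⟩ := hα.exists_param
        obtain ⟨s, hs, rfl⟩ := hp
        rw [dist_self] at hs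
        rw [le_antisymm hs.2 hs.1, f0])
    rw [Metric.infEDist_zero_of_mem (this ▸ Or.inl hβ.left_mem)]
    exact zero_le
  · obtain ⟨T, hT, rfl, h2, h3⟩ := exists_mem_vertexTriangles hab hα hβ hγ hd
    exact (Metric.infEDist_anti (Set.union_subset_union h2 h3)).trans
      (infEDist_le_vertexHypConst hT hp)

/-- All geodesic triangles whose vertices are vertices of the graph are thin. -/
theorem infEDist_le_of_vertex_triangle {x y z : V} {α β γ : Set (MetricGraph G hG)}
    (hα : IsGeodesicSegment (vtx G hG x) (vtx G hG y) α)
    (hβ : IsGeodesicSegment (vtx G hG y) (vtx G hG z) β)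
    (hγ : IsGeodesicSegment (vtx G hG x) (vtx G hG z) γ) {p : MetricGraph G hG} (hp : p ∈ α) :
    Metric.infEDist p (β ∪ γ) ≤ vertexHypConst G hG := by
  by_cases hpS : p ∈ β ∪ γ
  · rw [Metric.infEDist_zero_of_mem hpS]
    exact zero_le
  have hsat : EdgeSaturated (β ∪ γ) := (edgeSaturated hβ).union (edgeSaturated hγ)
  have hcl : IsClosed (β ∪ γ) := hβ.isClosed.union hγ.isClosed
  obtain ⟨f, f0, f1, hf, rfl⟩ := hα.exists_param
  obtain ⟨s, hs, rfl⟩ := hp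
  generalize dist (vtx G hG x) (vtx G hG y) = L at *
  have hL : 0 ≤ L := hs.1.trans hs.2
  have hpre : IsClosed (Set.Icc 0 L ∩ f ⁻¹' (β ∪ γ)) :=
    hf.continuousOn.preimage_isClosed_of_isClosed isClosed_Icc hcl
  -- the last point before `p` and the first one after it
  have hK₁ : IsCompact (Set.Icc 0 s ∩ (Set.Icc 0 L ∩ f ⁻¹' (β ∪ γ))) :=
    isCompact_Icc.inter_right hpre
  have hK₂ : IsCompact (Set.Icc s L ∩ (Set.Icc 0 L ∩ f ⁻¹' (β ∪ γ))) :=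
    isCompact_Icc.inter_right hpre
  obtain ⟨t₁, ⟨h₁s, h₁, h₁S⟩, hmax⟩ := hK₁.exists_isGreatest
    ⟨0, ⟨le_rfl, hs.1⟩, ⟨le_rfl, hL⟩, by rw [Set.mem_preimage, f0]; exact Or.inr hγ.left_mem⟩
  obtain ⟨t₂, ⟨h₂s, h₂, h₂S⟩, hmin⟩ := hK₂.exists_isLeast
    ⟨L, ⟨hs.2, le_rfl⟩, ⟨hL, le_rfl⟩, by rw [Set.mem_preimage, f1]; exact Or.inl hβ.left_mem⟩
  rw [Set.mem_preimage] at h₁S h₂S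
  have hgap : ∀ r ∈ Set.Ioo t₁ t₂, f r ∉ β ∪ γ := by
    intro r hr hrS
    have hr' : r ∈ Set.Icc 0 L := ⟨h₁.1.trans hr.1.le, hr.2.le.trans h₂.2⟩
    rcases le_total r s with h | h
    · have := hmax ⟨⟨hr'.1, h⟩, hr', hrS⟩
      linarith [hr.1]
    · have := hmin ⟨⟨h, hr'.2⟩, hr', hrS⟩
      linarith [hr.2]
  have hne₁ : t₁ < s := lt_of_le_of_ne h₁s.2 fun h => hpS (h ▸ h₁S)
  have hne₂ : s < t₂ := lt_of_le_of_ne h₂s.1 fun h => hpS (h ▸ h₂S)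
  -- At a non-vertex end of the gap, the saturated set `β ∪ γ` would be a neighbourhood and would
  -- reach into the gap.
  have hvert : ∀ t, t ∈ Set.Icc 0 L → t = t₁ ∨ t = t₂ → f t ∈ β ∪ γ → (f t).IsVertex := by
    intro t ht htt htS
    by_contra hv
    have hc := (hf.continuousOn t ht).preimage_mem_nhdsWithin (hsat.mem_nhds htS hv)
    have hIoo : Set.Ioo t₁ t₂ ⊆ Set.Icc 0 L := fun r hr =>
      ⟨h₁.1.trans hr.1.le, hr.2.le.trans h₂.2⟩
    have : (nhdsWithin t (Set.Ioo t₁ t₂)).NeBot := by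
      rcases htt with rfl | rfl
      · rw [nhdsWithin_Ioo_eq_nhdsGT (hne₁.trans hne₂)]
        infer_instance
      · rw [nhdsWithin_Ioo_eq_nhdsLT (hne₁.trans hne₂)]
        infer_instance
    obtain ⟨r, hr, hr'⟩ := Filter.nonempty_of_mem
      (Filter.inter_mem (nhdsWithin_mono t hIoo hc) self_mem_nhdsWithin)
    exact hgap r hr' hr
  obtain ⟨a, ha⟩ := isVertex_iff.mp (hvert t₁ h₁ (Or.inl rfl) h₁S)
  obtain ⟨b, hb⟩ := isVertex_iff.mp (hvert t₂ h₂ (Or.inr rfl) h₂S)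
  have hα' := hf.isGeodesicSegment h₁.1 (hne₁.trans hne₂).le h₂.2
  rw [ha, hb] at hα'
  have hp' : f s ∈ f '' Set.Icc t₁ t₂ := ⟨s, ⟨hne₁.le, hne₂.le⟩, rfl⟩
  have hd : f '' Set.Icc t₁ t₂ ∩ (β ∪ γ) ⊆ {vtx G hG a, vtx G hG b} := by
    rintro q ⟨⟨r, hr, rfl⟩, hrS⟩
    rcases hr.1.eq_or_lt with h | h
    · exact Or.inl (h ▸ ha)
    rcases hr.2.eq_or_lt with h' | h'
    · exact Or.inr (h' ▸ hb)
    exact absurd hrS (hgap r ⟨h, h'⟩)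
  have fin : ∀ (w : V) (β' γ' : Set (MetricGraph G hG)), β' ∪ γ' ⊆ β ∪ γ →
      IsGeodesicSegment (vtx G hG b) (vtx G hG w) β' →
      IsGeodesicSegment (vtx G hG a) (vtx G hG w) γ' →
      Metric.infEDist (f s) (β ∪ γ) ≤ vertexHypConst G hG := by
    intro w β' γ' hsub hβ' hγ'
    exact (Metric.infEDist_anti hsub).trans (infEDist_le_of_segments hα' hβ' hγ'
      ((Set.inter_subset_inter_right _ hsub).trans hd) hp')
  -- Both ends of the gap lie on the same side: that side joins them, and the third corner
  -- degenerates to `b`.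
  have one : ∀ S ⊆ β ∪ γ, (∃ u v, IsGeodesicSegment (vtx G hG u) (vtx G hG v) S) →
      vtx G hG a ∈ S → vtx G hG b ∈ S →
      Metric.infEDist (f s) (β ∪ γ) ≤ vertexHypConst G hG := by
    rintro S hS ⟨u, v, hs⟩ haS hbS
    obtain ⟨R, hR, hR'⟩ := hs.exists_subset haS hbS
    exact fin b {vtx G hG b} R (Set.union_subset (Set.singleton_subset_iff.mpr (hS hbS))
      (hR.trans hS)) (IsGeodesicSegment.refl _) hR'
  rw [ha] at h₁S
  rw [hb] at h₂S
  rcases h₁S with haS | haS <;> rcases h₂S with hbS | hbS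
  · exact one β Set.subset_union_left ⟨_, _, hβ⟩ haS hbS
  -- The ends lie on different sides, and each runs along its own side to the common corner `z`.
  · obtain ⟨R, hR, hR'⟩ := hβ.exists_subset haS hβ.right_mem
    obtain ⟨Q, hQ, hQ'⟩ := hγ.exists_subset hbS hγ.right_mem
    exact fin z Q R (Set.union_comm Q R ▸ Set.union_subset_union hR hQ) hQ' hR'
  · obtain ⟨R, hR, hR'⟩ := hβ.exists_subset hbS hβ.right_mem
    obtain ⟨Q, hQ, hQ'⟩ := hγ.exists_subset haS hγ.right_mem
    exact fin z R Q (Set.union_subset_union hR hQ) hR' hQ'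
  · exact one γ Set.subset_union_right ⟨_, _, hγ⟩ haS hbS

end MetricGraph

end Graph

/-! ### Half-integrality and attainment of the maximum -/

section Graph

variable {V : Type*}

namespace MetricGraph

variable {G : SimpleGraph V} {hG : G.Connected} {S : Set (MetricGraph G hG)}

theorem EdgeSaturated.vtx_mem (hS : EdgeSaturated S) {q : MetricGraph G hG} (hq : q ∈ S) {u : V}
    (hu : q.1 u ≠ 0) : vtx G hG u ∈ S := by
  rcases q.isVertex_or with h | ⟨a, b, hab, ha, hb⟩
  · obtain ⟨w, rfl⟩ := isVertex_iff.mp h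
    rwa [vtx_ne_zero.mp hu]
  · have h := hS q hq a b hab.ne ha hb
    rcases q.support_subset_pair hab.ne ha hb hu with rfl | h'
    · exact h (vtx_left_mem_edgeSet _ _)
    · obtain rfl : u = b := h'
      exact h (vtx_right_mem_edgeSet _ _)

/-- A shortest path from a nearest point `q` of `S` to `a` passes through an endpoint `u` of the
edge of `q`. By saturation `u` is in `S`, so minimality makes the distance equal to `G.dist u a`. -/
theorem exists_infDist_vtx_eq (hS : EdgeSaturated S) (hc : IsCompact S) (hne : S.Nonempty) (a : V) :
    ∃ n : ℕ, Metric.infDist (vtx G hG a) S = n := by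
  obtain ⟨q, hq, h⟩ := hc.exists_infDist_eq_dist hne (vtx G hG a)
  obtain ⟨u, hu, h1⟩ := q.exists_dist_vtx a
  have h2 := Metric.infDist_le_dist_of_mem (x := vtx G hG a) (hS.vtx_mem hq hu)
  rw [h, dist_comm, dist_vtx_vtx, G.dist_comm] at h2
  rw [dist_comm] at h
  exact ⟨G.dist u a, by linarith [q.le_one u]⟩

/-- As `m` is not in `S`, saturation keeps `S` off the interior of its edge. A path from `m` to `S`
must therefore spend `1/2` to reach an endpoint, and at least `k` more from there. -/
theorem le_infDist_midpoint (hS : EdgeSaturated S) (hne : S.Nonempty) {a b : V} (hab : G.Adj a b)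
    {m : MetricGraph G hG} (ha : m.1 a = 1 / 2) (hb : m.1 b = 1 / 2) (hm : m ∉ S) {k : ℝ}
    (hka : k ≤ Metric.infDist (vtx G hG a) S) (hkb : k ≤ Metric.infDist (vtx G hG b) S) :
    k + 1 / 2 ≤ Metric.infDist m S := by
  rw [Metric.le_infDist hne]
  intro q hq
  have hma : m.1 a ≠ 0 := by rw [ha]; norm_num
  have hmb : m.1 b ≠ 0 := by rw [hb]; norm_num
  have hsupp := m.support_subset_pair hab.ne hma hmb
  have hdist : ∀ u, u = a ∨ u = b → m.1 u = 1 / 2 ∧ k ≤ dist (vtx G hG u) q := by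
    rintro u (rfl | rfl)
    · exact ⟨ha, hka.trans (Metric.infDist_le_dist_of_mem hq)⟩
    · exact ⟨hb, hkb.trans (Metric.infDist_le_dist_of_mem hq)⟩
  rcases isPathLength_dist m q with ⟨u, v, huv, hx, hy, -⟩ | ⟨u, v, hu, hv, h1⟩
  · have hq' : ∀ w, q.1 w ≠ 0 → w = a ∨ w = b := by
      intro w hw
      have h1 := hx hma
      have h2 := hx hmb
      have h3 := hy hw
      have := hab.ne
      simp only [Set.mem_insert_iff, Set.mem_singleton_iff] at h1 h2 h3
      grind
    have hqv : q.IsVertex := by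
      by_contra hqv
      obtain ⟨c, d, hcd, hc, hd⟩ := q.isVertex_or.resolve_left hqv
      have hqab : q.1 a ≠ 0 ∧ q.1 b ≠ 0 := by
        have := hcd.ne
        rcases hq' c hc with rfl | rfl <;> rcases hq' d hd with rfl | rfl
        · exact absurd rfl this
        · exact ⟨hc, hd⟩
        · exact ⟨hd, hc⟩
        · exact absurd rfl this
      exact hm (hS q hq a b hab.ne hqab.1 hqab.2 hsupp)
    obtain ⟨w, rfl⟩ := isVertex_iff.mp hqv
    obtain ⟨h1, h2⟩ := hdist w (hq' w (vtx_ne_zero.mpr rfl))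
    rw [m.dist_vtx_of_ne_zero (by rw [h1]; norm_num), h1]
    rw [dist_self] at h2
    linarith
  · obtain ⟨h2, h3⟩ := hdist u (hsupp hu)
    have h4 := q.dist_vtx_le hv u
    rw [dist_comm, G.dist_comm] at h4
    rw [h1, h2]
    linarith

/-- On a geodesic between vertices the distance to an edge-saturated set attains its maximum
at a vertex or a midpoint, and the maximum is a multiple of `1 / 2`. -/
theorem exists_infDist_eq_half {a b : V} {α : Set (MetricGraph G hG)}
    (hα : IsGeodesicSegment (vtx G hG a) (vtx G hG b) α) (hS : EdgeSaturated S)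
    (hc : IsCompact S) (haS : vtx G hG a ∈ S) {p : MetricGraph G hG} (hp : p ∈ α) :
    ∃ q ∈ α ∩ vertexMidpointSet G hG, ∃ n : ℕ, Metric.infDist q S = n / 2 ∧
      Metric.infDist p S ≤ n / 2 := by
  have hne : S.Nonempty := ⟨_, haS⟩
  by_cases hpS : p ∈ S
  · exact ⟨_, ⟨hα.left_mem, Or.inl (isVertex_vtx a)⟩, 0,
      by simp [Metric.infDist_zero_of_mem haS], by simp [Metric.infDist_zero_of_mem hpS]⟩
  have vert : ∀ w, vtx G hG w ∈ α → Metric.infDist p S ≤ Metric.infDist (vtx G hG w) S →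
      ∃ q ∈ α ∩ vertexMidpointSet G hG, ∃ n : ℕ, Metric.infDist q S = n / 2 ∧
        Metric.infDist p S ≤ n / 2 := by
    intro w hw hle
    obtain ⟨n, hn⟩ := exists_infDist_vtx_eq hS hc hne w
    refine ⟨_, ⟨hw, Or.inl (isVertex_vtx w)⟩, 2 * n, ?_⟩
    have : ((2 * n : ℕ) : ℝ) / 2 = n := by push_cast; ring
    rw [this, ← hn]
    exact ⟨rfl, hle⟩
  by_cases hv : p.IsVertex
  · obtain ⟨w, rfl⟩ := isVertex_iff.mp hv
    exact vert w hp le_rfl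
  obtain ⟨u, v, huv, hu, hv⟩ := p.isVertex_or.resolve_left hv
  have hedge := edgeSaturated hα p hp u v huv.ne hu hv
  have hsum := (p.adj_of_ne_zero hu hv huv.ne).2
  have du := p.dist_vtx_of_ne_zero hu
  have dv := p.dist_vtx_of_ne_zero hv
  have pu := (p.nonneg u).lt_of_ne' hu
  have pv := (p.nonneg v).lt_of_ne' hv
  have lu := Metric.infDist_le_infDist_add_dist (s := S) (x := p) (y := vtx G hG u)
  have lv := Metric.infDist_le_infDist_add_dist (s := S) (x := p) (y := vtx G hG v)
  obtain ⟨n, hn⟩ := exists_infDist_vtx_eq hS hc hne u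
  obtain ⟨k, hk⟩ := exists_infDist_vtx_eq hS hc hne v
  -- If the integer distances at the ends differ, the farther end dominates the whole edge, which
  -- has length 1. If both equal `n`, the midpoint has distance `n + 1/2`, and `p` is within `1/2`
  -- of one of the ends.
  rcases lt_trichotomy n k with h | rfl | h
  · have : (n : ℝ) + 1 ≤ k := by exact_mod_cast h
    exact vert v (hedge (vtx_right_mem_edgeSet u v)) (by linarith)
  · have hh : (1 / 2 : ℝ) ∈ Set.Icc (0 : ℝ) 1 := by norm_num
    set m := edgePoint hG huv (1 / 2) hh
    have hm : m ∈ edgeSet G hG u v := edgePoint_mem huv hh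
    have mu : m.1 u = 1 / 2 := by rw [edgePoint_left]; norm_num
    have mv : m.1 v = 1 / 2 := by linarith [m.sum_eq_one huv.ne hm]
    have hmS : m ∉ S := fun h => hpS (hS m h u v huv.ne (by rw [mu]; norm_num)
      (by rw [mv]; norm_num) (p.support_subset_pair huv.ne hu hv))
    have h1 := le_infDist_midpoint hS hne huv mu mv hmS hn.ge hk.ge
    have h2 := Metric.infDist_le_infDist_add_dist (s := S) (x := m) (y := vtx G hG u)
    rw [m.dist_vtx_of_ne_zero (by rw [mu]; norm_num), mu] at h2
    refine ⟨m, ⟨hedge hm, Or.inr ⟨u, v, huv, mu, mv⟩⟩, 2 * n + 1, ?_⟩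
    have : ((2 * n + 1 : ℕ) : ℝ) / 2 = n + 1 / 2 := by push_cast; ring
    rw [this]
    refine ⟨by linarith, ?_⟩
    rcases le_total (p.1 u) (p.1 v) with h | h <;> linarith
  · have : (k : ℝ) + 1 ≤ n := by exact_mod_cast h
    exact vert u (hedge (vtx_left_mem_edgeSet u v)) (by linarith)

theorem exists_infEDist_eq_half {T : GeodesicTriangle (MetricGraph G hG)}
    (hT : T ∈ vertexTriangles G hG) {p : MetricGraph G hG} (hp : p ∈ T.xy) :
    ∃ q ∈ T.xy ∩ vertexMidpointSet G hG, ∃ n : ℕ,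
      Metric.infEDist q (T.yz ∪ T.zx) = ((n / 2 : ℝ≥0) : ℝ≥0∞) ∧
      Metric.infEDist p (T.yz ∪ T.zx) ≤ ((n / 2 : ℝ≥0) : ℝ≥0∞) := by
  obtain ⟨-, hx, hy, hz⟩ := hT
  obtain ⟨x, hx⟩ := isVertex_iff.mp hx
  obtain ⟨y, hy⟩ := isVertex_iff.mp hy
  obtain ⟨z, hz⟩ := isVertex_iff.mp hz
  have h1 := T.isGeodesic_xy
  have h2 := T.isGeodesic_yz
  have h3 := T.isGeodesic_zx
  rw [hx, hy] at h1
  rw [hy, hz] at h2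
  rw [hz, hx] at h3
  obtain ⟨q, hq, n, h4, h5⟩ := exists_infDist_eq_half h1
    ((edgeSaturated h2).union (edgeSaturated h3)) (h2.isCompact.union h3.isCompact)
    (Or.inr h3.right_mem) hp
  have hne : (T.yz ∪ T.zx).Nonempty := ⟨_, Or.inr h3.right_mem⟩
  have hcoe : ((n / 2 : ℝ≥0) : ℝ≥0∞) = ENNReal.ofReal (n / 2) := by
    rw [← ENNReal.ofReal_coe_nnreal]
    simp
  refine ⟨q, hq, n, ?_, ?_⟩
  · rw [hcoe, ← h4, Metric.infDist, ENNReal.ofReal_toReal (Metric.infEDist_ne_top hne)]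
  · rw [hcoe]
    refine ENNReal.le_ofReal_iff_toReal_le (Metric.infEDist_ne_top hne) (by positivity) |>.mpr h5

/-- If `δ_v(G)` is finite, then it is attained at a vertex or a midpoint. -/
theorem exists_thinConst_eq_vertexHypConst (hfin : vertexHypConst G hG < ⊤)
    (hne : (vertexTriangles G hG).Nonempty) :
    ∃ n : ℕ, vertexHypConst G hG = ((n / 2 : ℝ≥0) : ℝ≥0∞) ∧ ∃ T ∈ vertexTriangles G hG,
      ∃ p ∈ T.xy ∩ vertexMidpointSet G hG, Metric.infEDist p (T.yz ∪ T.zx) = T.thinConst ∧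
        T.thinConst = vertexHypConst G hG := by
  -- Twice the distances at vertices and midpoints. These are integers bounded by `2 δ_v`, so the
  -- supremum is attained.
  let N : Set ℕ := {n | ∃ T ∈ vertexTriangles G hG, ∃ q ∈ T.xy ∩ vertexMidpointSet G hG,
    Metric.infEDist q (T.yz ∪ T.zx) = ((n / 2 : ℝ≥0) : ℝ≥0∞)}
  have hN : N.Nonempty := by
    obtain ⟨T, hT⟩ := hne
    obtain ⟨q, hq, n, h, -⟩ := exists_infEDist_eq_half hT T.isGeodesic_xy.left_mem
    exact ⟨n, T, hT, q, hq, h⟩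
  have hbdd : BddAbove N := by
    refine ⟨⌈2 * (vertexHypConst G hG).toNNReal⌉₊, ?_⟩
    rintro n ⟨T, hT, q, hq, h⟩
    have h1 := infEDist_le_vertexHypConst hT hq.1
    rw [h, ← ENNReal.coe_toNNReal hfin.ne, ENNReal.coe_le_coe] at h1
    have h2 : (n : ℝ≥0) ≤ 2 * (vertexHypConst G hG).toNNReal := by
      rwa [div_le_iff₀ (by norm_num), mul_comm] at h1
    exact_mod_cast h2.trans (Nat.le_ceil _)
  obtain ⟨T, hT, q, hq, h⟩ := Nat.sSup_mem hN hbdd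
  have hle : ∀ T' ∈ vertexTriangles G hG, ∀ p ∈ T'.xy,
      Metric.infEDist p (T'.yz ∪ T'.zx) ≤ ((sSup N / 2 : ℝ≥0) : ℝ≥0∞) := by
    intro T' hT' p hp
    obtain ⟨q', hq', k, h1, h2⟩ := exists_infEDist_eq_half hT' hp
    refine h2.trans ?_
    have : k ≤ sSup N := le_csSup hbdd ⟨T', hT', q', hq', h1⟩
    have : (k : ℝ≥0) ≤ sSup N := by exact_mod_cast this
    rw [ENNReal.coe_le_coe]
    gcongr
  have hthin : ∀ T' ∈ vertexTriangles G hG, T'.IsThin (sSup N / 2 : ℝ≥0) := by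
    intro T' hT'
    rw [GeodesicTriangle.isThin_iff]
    exact ⟨hle _ hT', hle _ (rotate_mem_vertexTriangles hT'),
      hle _ (rotate_mem_vertexTriangles (rotate_mem_vertexTriangles hT'))⟩
  have e1 : vertexHypConst G hG = ((sSup N / 2 : ℝ≥0) : ℝ≥0∞) :=
    le_antisymm (iInf₂_le _ hthin) (h ▸ infEDist_le_vertexHypConst hT hq.1)
  have e2 : T.thinConst = ((sSup N / 2 : ℝ≥0) : ℝ≥0∞) :=
    le_antisymm (GeodesicTriangle.thinConst_le (hthin T hT)) (h ▸ T.infEDist_le_thinConst hq.1)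
  exact ⟨sSup N, e1, T, hT, q, hq, h.trans e2.symm, e2.trans e1.symm⟩

/-! ### Graphs which are not trees -/

/-- A connected graph that is not a tree has an edge avoided by geodesics from its endpoints
to some vertex. -/
theorem exists_adj_of_not_isTree (hG : G.Connected) (h : ¬ G.IsTree) : ∃ w a b, G.Adj a b ∧
    ∀ u v, s(u, v) = s(a, b) → u = w ∨ ∃ c ≠ v, G.Adj u c ∧ G.dist u w = G.dist c w + 1 := by
  classical
  obtain ⟨w⟩ := hG.nonempty
  by_contra! hcon
  refine h ⟨hG, fun r c hc => ?_⟩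
  -- By `hcon`, every edge has an endpoint, other than `w`, whose only neighbour nearer to `w` is
  -- the other endpoint. Let `u` be farthest from `w` on the cycle. For either cycle edge at `u`
  -- that endpoint must be `u` itself, so both cycle neighbours would be the unique nearer neighbour
  -- of `u`; but they are distinct.
  obtain ⟨u, hu, hmax⟩ := Set.Finite.exists_maximalFor (fun x => G.dist x w) {x | x ∈ c.support}
    c.support.finite_toSet ⟨r, c.start_mem_support⟩
  have hc' := hc.rotate hu
  set c' := c.rotate u hu
  have hmem : ∀ x ∈ c'.support, G.dist x w ≤ G.dist u w := by
    intro x hx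
    have : x ∈ c.support := by
      rwa [SimpleGraph.Walk.mem_support_rotate_iff] at hx
    rcases le_total (G.dist u w) (G.dist x w) with h | h
    · exact hmax this h
    · exact h
  have key : ∀ x, G.Adj u x → G.dist x w ≤ G.dist u w → u ≠ w ∧
      ∀ c, c ≠ x → G.Adj u c → G.dist u w ≠ G.dist c w + 1 := by
    intro x hx hle
    obtain ⟨u', v', he, hne, h1⟩ := hcon w u x hx
    rcases Sym2.eq_iff.mp he with ⟨rfl, rfl⟩ | ⟨rfl, rfl⟩
    · exact ⟨hne, h1⟩
    · exfalso
      obtain ⟨d, hd, hd'⟩ := exists_adj_dist_eq hG hne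
      by_cases hdu : d = v'
      · rw [hdu] at hd'
        omega
      · exact h1 d hdu hd hd'
  have hnil := hc'.not_nil
  have k1 := key _ (c'.adj_snd hnil) (hmem _ (c'.getVert_mem_support _))
  have k2 := key _ (c'.adj_penultimate hnil).symm (hmem _ (c'.getVert_mem_support _))
  obtain ⟨d, hd, hd'⟩ := exists_adj_dist_eq hG k1.1
  by_cases h1 : d = c'.snd
  · exact k2.2 d (h1 ▸ hc'.snd_ne_penultimate) hd hd'
  · exact k1.2 d h1 hd hd'

/-- Start the geodesic with the edge `[a, c]`. If it met the support of `b`, saturation would put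
`b` on it, at the same distance 1 from `a` as `c`, forcing `b = c`. -/
theorem exists_isGeodesicSegment_avoiding {w a b : V} (hab : G.Adj a b)
    (h : a = w ∨ ∃ c ≠ b, G.Adj a c ∧ G.dist a w = G.dist c w + 1) :
    ∃ S, IsGeodesicSegment (vtx G hG a) (vtx G hG w) S ∧ ∀ q ∈ S, q.1 a ≠ 0 → q.1 b = 0 := by
  rcases h with rfl | ⟨c, hcb, hac, hd⟩
  · refine ⟨_, IsGeodesicSegment.refl _, fun q hq _ => ?_⟩
    rw [Set.mem_singleton_iff.mp hq, vtx_of_ne hab.ne']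
  · obtain ⟨R, hR⟩ := exists_isGeodesicSegment hG c w
    have hS := isGeodesicSegment_edgeSet_union hac hd hR
    refine ⟨_, hS, fun q hq ha => ?_⟩
    by_contra hb
    have h1 := (edgeSaturated hS).vtx_mem hq hb
    refine hcb (vtx_injective (hS.eq_of_dist_eq (Or.inl (vtx_right_mem_edgeSet a c)) h1 ?_))
    rw [dist_vtx_vtx, dist_vtx_vtx, SimpleGraph.dist_eq_one_iff_adj.mpr hac,
      SimpleGraph.dist_eq_one_iff_adj.mpr hab]

/-- On the two geodesics avoiding the edge `[a, b]`, one of the coordinates `a`, `b` vanishes, while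
both are `1/2` at the midpoint. Since coordinates are 1-Lipschitz, the distance is at least `1/2`.
-/
theorem exists_triangle_of_not_isTree (hG : G.Connected) (h : ¬ G.IsTree) :
    (vertexTriangles G hG).Nonempty ∧ ((1 / 2 : ℝ≥0) : ℝ≥0∞) ≤ vertexHypConst G hG := by
  obtain ⟨w, a, b, hab, hw⟩ := exists_adj_of_not_isTree hG h
  obtain ⟨γ, hγ, hγ'⟩ := exists_isGeodesicSegment_avoiding (hG := hG) hab (hw a b rfl)
  obtain ⟨β, hβ, hβ'⟩ := exists_isGeodesicSegment_avoiding (hG := hG) hab.symm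
    (hw b a Sym2.eq_swap)
  have hS : ∀ q ∈ β ∪ γ, q.1 a = 0 ∨ q.1 b = 0 := by
    rintro q (hq | hq)
    · by_cases hb : q.1 b = 0
      · exact Or.inr hb
      · exact Or.inl (hβ' q hq hb)
    · by_cases ha : q.1 a = 0
      · exact Or.inl ha
      · exact Or.inr (hγ' q hq ha)
  obtain ⟨T, hT, h1, h2, h3⟩ := exists_mem_vertexTriangles hab.ne (isGeodesicSegment_edgeSet hab)
    hβ hγ (by
      rintro q ⟨hq, hqS⟩
      have := q.sum_eq_one hab.ne hq
      rcases hS q hqS with h0 | h0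
      · exact Or.inr (eq_vtx (by linarith))
      · exact Or.inl (eq_vtx (by linarith)))
  refine ⟨⟨T, hT⟩, ?_⟩
  have hh : (1 / 2 : ℝ) ∈ Set.Icc (0 : ℝ) 1 := by norm_num
  set m := edgePoint hG hab (1 / 2) hh
  have hm : m ∈ edgeSet G hG a b := edgePoint_mem hab hh
  have ma : m.1 a = 1 / 2 := by rw [edgePoint_left]; norm_num
  have mb : m.1 b = 1 / 2 := by linarith [m.sum_eq_one hab.ne hm]
  refine le_trans ?_ (infEDist_le_vertexHypConst hT (p := m) (h1 ▸ hm))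
  rw [Metric.le_infEDist]
  intro q hq
  have hd : (1 / 2 : ℝ) ≤ dist m q := by
    rcases hS q (Set.union_subset_union h2 h3 hq) with h0 | h0
    · have := (le_abs_self _).trans (abs_sub_le_dist m q a)
      rwa [h0, ma, sub_zero] at this
    · have := (le_abs_self _).trans (abs_sub_le_dist m q b)
      rwa [h0, mb, sub_zero] at this
  rw [edist_dist, ← ENNReal.ofReal_coe_nnreal]
  exact ENNReal.ofReal_le_ofReal (by simpa using hd)

end MetricGraph

end Graph

section Graph

variable {V : Type*}

namespace MetricGraph

variable {G : SimpleGraph V} {hG : G.Connected} {S : Set (MetricGraph G hG)}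

/-! ### Trees -/

/-- An interior point of a bridge separates the metric graph. -/
theorem exists_separation {a b : V} (hbr : G.IsBridge s(a, b)) (hab : G.Adj a b)
    {p : MetricGraph G hG} (ha : p.1 a ≠ 0) (hb : p.1 b ≠ 0) :
    ∃ U W : Set (MetricGraph G hG), IsOpen U ∧ IsOpen W ∧ Disjoint U W ∧ {p}ᶜ ⊆ U ∪ W ∧
      (∀ q ∈ U, q.1.support ⊆ {a, b} → p.1 b < q.1 b) ∧
      ∀ q ∈ W, q.1.support ⊆ {a, b} → q.1 b < p.1 b := by
  let B : Set V := {v | (G.deleteEdges {s(a, b)}).Reachable b v}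
  have hbB : b ∈ B := SimpleGraph.Reachable.refl b
  have haB : a ∉ B := fun h => SimpleGraph.isBridge_iff.mp hbr (SimpleGraph.Reachable.symm h)
  have hcut : ∀ u v, G.Adj u v → u ∈ B → v ∉ B → u = b ∧ v = a := by
    intro u v huv hu hv
    by_contra hc
    refine hv (SimpleGraph.Reachable.trans hu (SimpleGraph.Adj.reachable ?_))
    rw [SimpleGraph.deleteEdges_adj]
    refine ⟨huv, fun h => ?_⟩
    rcases Sym2.eq_iff.mp h with ⟨rfl, rfl⟩ | ⟨rfl, rfl⟩
    · exact haB hu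
    · exact hc ⟨rfl, rfl⟩
  have hsum := (p.adj_of_ne_zero ha hb hab.ne).2
  have hopen : ∀ (C : Set V) (c : V) (r : ℝ), IsOpen
      ((⋃ v ∈ C, {q : MetricGraph G hG | q.1 v ≠ 0}) ∪ {q : MetricGraph G hG | r < q.1 c}) :=
    fun C c r => (isOpen_biUnion fun v _ => isOpen_coord_ne_zero v).union
      (isOpen_lt continuous_const (continuous_coord c))
  have hadj : ∀ (q : MetricGraph G hG) u v, q.1 u ≠ 0 → q.1 v ≠ 0 → u ∈ B → v ∉ B →
      u = b ∧ v = a := by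
    intro q u v hu hv huB hvB
    have huv : u ≠ v := by
      rintro rfl
      exact hvB huB
    exact hcut u v (q.adj_of_ne_zero hu hv huv).1 huB hvB
  -- `B` is the side of `b` once the bridge is deleted. `U` consists of the points touching `B` away
  -- from `b`, or with larger `b`-coordinate than `p`; `W` is the analogue for `a`.
  refine ⟨_, _, hopen {v | v ∈ B ∧ v ≠ b} b (p.1 b), hopen {v | v ∉ B ∧ v ≠ a} a (p.1 a),
    ?_, ?_, ?_, ?_⟩
  · rw [Set.disjoint_left]
    intro q hU hW
    simp only [Set.mem_union, Set.mem_iUnion, Set.mem_ofPred_eq, exists_prop] at hU hW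
    rcases hU with ⟨u, ⟨huB, hub⟩, hu⟩ | hU <;> rcases hW with ⟨v, ⟨hvB, hva⟩, hv⟩ | hW
    · exact hub (hadj q u v hu hv huB hvB).1
    · exact hub (hadj q u a hu ((p.nonneg a).trans_lt hW).ne' huB haB).1
    · exact hva (hadj q b v ((p.nonneg b).trans_lt hU).ne' hv hbB hvB).2
    · have := q.add_le_one hab.ne
      linarith
  · intro q hq
    simp only [Set.mem_union, Set.mem_iUnion, Set.mem_ofPred_eq, exists_prop]
    by_cases hs : q.1.support ⊆ {a, b}
    · have hs' := q.sum_eq_one hab.ne hs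
      rcases lt_trichotomy (p.1 b) (q.1 b) with h | h | h
      · exact Or.inl (Or.inr h)
      · exact absurd (ext_of_support hab.ne hs (p.support_subset_pair hab.ne ha hb)
          (by linarith)) hq
      · exact Or.inr (Or.inr (by linarith))
    · obtain ⟨v, hv, hv'⟩ := Set.not_subset.mp hs
      simp only [Set.mem_insert_iff, Set.mem_singleton_iff, not_or] at hv'
      by_cases hvB : v ∈ B
      · exact Or.inl (Or.inl ⟨v, ⟨hvB, hv'.2⟩, hv⟩)
      · exact Or.inr (Or.inl ⟨v, ⟨hvB, hv'.1⟩, hv⟩)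
  · intro q hq hs
    simp only [Set.mem_union, Set.mem_iUnion, Set.mem_ofPred_eq, exists_prop] at hq
    rcases hq with ⟨v, ⟨hvB, hvb⟩, hv⟩ | h
    · rcases hs hv with rfl | h
      · exact absurd hvB haB
      · exact absurd h hvb
    · exact h
  · intro q hq hs
    have hs' := q.sum_eq_one hab.ne hs
    simp only [Set.mem_union, Set.mem_iUnion, Set.mem_ofPred_eq, exists_prop] at hq
    rcases hq with ⟨v, ⟨hvB, hva⟩, hv⟩ | h
    · rcases hs hv with h | h
      · exact absurd h hva
      · exact absurd (Set.mem_singleton_iff.mp h ▸ hbB) hvB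
    · linarith

theorem subset_of_separation {U W : Set (MetricGraph G hG)} (hU : IsOpen U) (hW : IsOpen W)
    (hUW : Disjoint U W) {p : MetricGraph G hG} (hp : {p}ᶜ ⊆ U ∪ W) {C : Set (MetricGraph G hG)}
    (hC : IsPreconnected C) (hpC : p ∉ C) {x y : MetricGraph G hG} (hx : x ∈ C) (hy : y ∈ C)
    (hxU : x ∈ U) : y ∈ U :=
  hC.subset_left_of_subset_union hU hW hUW
    (fun _ hq => hp fun h => hpC (Set.mem_singleton_iff.mp h ▸ hq)) ⟨x, hx, hxU⟩ hy

/-- If the connected set `S` missed `γ s`, it would keep `x` and `y` on one side of `γ s`. The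
points `γ (s - ε)` and `γ (s + ε)` would then be on that side too, on the same edge and equally far
from `γ s`, hence equal. -/
theorem mem_of_isTree (hT : G.IsTree) {x y : MetricGraph G hG} {γ : ℝ → MetricGraph G hG} {L : ℝ}
    (h0 : γ 0 = x) (h1 : γ L = y) (hγ : IsUnitSpeedGeodesic γ L) (hS : IsPreconnected S)
    (hx : x ∈ S) (hy : y ∈ S) {s : ℝ} (hs : s ∈ Set.Icc 0 L) (hv : ¬ (γ s).IsVertex) :
    γ s ∈ S := by
  by_contra hpS
  obtain ⟨a, b, hab, ha, hb⟩ := (γ s).isVertex_or.resolve_left hv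
  have hs0 : 0 < s := lt_of_le_of_ne hs.1 fun h => hpS (by rw [← h, h0]; exact hx)
  have hsL : s < L := lt_of_le_of_ne hs.2 fun h => hpS (by rw [h, h1]; exact hy)
  have hbr : G.IsBridge s(a, b) := SimpleGraph.isAcyclic_iff_forall_adj_isBridge.mp hT.2 hab
  obtain ⟨U, W, hU, hW, hUW, hc, hU', hW'⟩ := exists_separation hbr hab ha hb
  have pa := ((γ s).nonneg a).lt_of_ne' ha
  have pb := ((γ s).nonneg b).lt_of_ne' hb
  obtain ⟨ε, hε, hlt⟩ : ∃ ε > 0, ε < min (min s (L - s)) (min ((γ s).1 a) ((γ s).1 b)) :=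
    exists_between (lt_min (lt_min hs0 (by linarith)) (lt_min pa pb))
  simp only [lt_min_iff] at hlt
  obtain ⟨⟨e1, e2⟩, e3, e4⟩ := hlt
  have hm₁ : s - ε ∈ Set.Icc 0 L := ⟨by linarith, by linarith⟩
  have hm₂ : s + ε ∈ Set.Icc 0 L := ⟨by linarith, by linarith⟩
  have hsupp : ∀ r ∈ Set.Icc 0 L, |r - s| = ε → (γ r).1.support ⊆ {a, b} ∧
      |(γ r).1 b - (γ s).1 b| = ε := by
    intro r hr hrs
    have hd := hγ r hr s hs
    have c1 := neg_le_of_abs_le (abs_sub_le_dist (γ r) (γ s) a)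
    have c2 := neg_le_of_abs_le (abs_sub_le_dist (γ r) (γ s) b)
    rw [hd, hrs] at c1 c2
    have hsup := (γ r).support_subset_pair hab.ne (u := a) (v := b)
      (by intro h; rw [h] at c1; linarith) (by intro h; rw [h] at c2; linarith)
    refine ⟨hsup, ?_⟩
    rw [← hrs, ← hd, dist_eq_abs hab.symm (by rwa [Set.pair_comm])
      (by rw [Set.pair_comm]; exact (γ s).support_subset_pair hab.ne ha hb)]
  have hA₁ : |s - ε - s| = ε := by
    rw [sub_sub_cancel_left, abs_neg, abs_of_pos hε]
  have hA₂ : |s + ε - s| = ε := by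
    rw [add_sub_cancel_left, abs_of_pos hε]
  obtain ⟨s₁, d₁⟩ := hsupp _ hm₁ hA₁
  obtain ⟨s₂, d₂⟩ := hsupp _ hm₂ hA₂
  have hC₁ : IsPreconnected (γ '' Set.Icc 0 (s - ε)) :=
    isPreconnected_Icc.image _ (hγ.continuousOn.mono (Set.Icc_subset_Icc le_rfl hm₁.2))
  have hC₂ : IsPreconnected (γ '' Set.Icc (s + ε) L) :=
    isPreconnected_Icc.image _ (hγ.continuousOn.mono (Set.Icc_subset_Icc hm₂.1 le_rfl))
  have hp₁ : γ s ∉ γ '' Set.Icc 0 (s - ε) := by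
    rintro ⟨r, hr, he⟩
    have := hγ.injOn ⟨hr.1, hr.2.trans hm₁.2⟩ hs he
    linarith [hr.2]
  have hp₂ : γ s ∉ γ '' Set.Icc (s + ε) L := by
    rintro ⟨r, hr, he⟩
    have := hγ.injOn ⟨hm₂.1.trans hr.1, hr.2⟩ hs he
    linarith [hr.1]
  have side : ∀ U' W' : Set (MetricGraph G hG), IsOpen U' → IsOpen W' → Disjoint U' W' →
      {γ s}ᶜ ⊆ U' ∪ W' → x ∈ U' → γ (s - ε) ∈ U' ∧ γ (s + ε) ∈ U' := by
    intro U' W' hU hW hUW hc hxU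
    have hyU := subset_of_separation hU hW hUW hc hS hpS hx hy hxU
    exact ⟨subset_of_separation hU hW hUW hc hC₁ hp₁ ⟨0, ⟨le_rfl, hm₁.1⟩, h0⟩
      ⟨_, ⟨hm₁.1, le_rfl⟩, rfl⟩ hxU,
      subset_of_separation hU hW hUW hc hC₂ hp₂ ⟨L, ⟨hm₂.2, le_rfl⟩, h1⟩
      ⟨_, ⟨le_rfl, hm₂.2⟩, rfl⟩ hyU⟩
  have heq : (γ (s - ε)).1 b = (γ (s + ε)).1 b := by
    rcases hc (show x ∈ {γ s}ᶜ from fun h => hpS (Set.mem_singleton_iff.mp h ▸ hx)) with hxU | hxW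
    · obtain ⟨k1, k2⟩ := side U W hU hW hUW hc hxU
      have l1 := hU' _ k1 s₁
      have l2 := hU' _ k2 s₂
      rw [abs_of_nonneg (by linarith)] at d₁ d₂
      linarith
    · obtain ⟨k1, k2⟩ := side W U hW hU hUW.symm (Set.union_comm U W ▸ hc) hxW
      have l1 := hW' _ k1 s₁
      have l2 := hW' _ k2 s₂
      rw [abs_of_nonpos (by linarith)] at d₁ d₂
      linarith
  have := hγ.injOn hm₁ hm₂ (ext_of_support hab.ne' (by rwa [Set.pair_comm])
    (by rwa [Set.pair_comm]) heq)
  linarith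

theorem infEDist_eq_zero_of_isTree (hT : G.IsTree) (T : GeodesicTriangle (MetricGraph G hG))
    {p : MetricGraph G hG} (hp : p ∈ T.xy) : Metric.infEDist p (T.yz ∪ T.zx) = 0 := by
  have hz : T.z ∈ T.yz := T.isGeodesic_yz.right_mem
  have hS : IsPreconnected (T.yz ∪ T.zx) := IsPreconnected.union T.z hz T.isGeodesic_zx.left_mem
    T.isGeodesic_yz.isPreconnected T.isGeodesic_zx.isPreconnected
  have hcl : IsClosed (T.yz ∪ T.zx) := T.isGeodesic_yz.isClosed.union T.isGeodesic_zx.isClosed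
  have hx : T.x ∈ T.yz ∪ T.zx := Or.inr T.isGeodesic_zx.right_mem
  have hy : T.y ∈ T.yz ∪ T.zx := Or.inl T.isGeodesic_yz.left_mem
  obtain ⟨γ, h0, h1, hγ, he⟩ := T.isGeodesic_xy.exists_param
  rw [← he] at hp
  obtain ⟨s, hs, rfl⟩ := hp
  refine Metric.infEDist_zero_of_mem ?_
  by_cases hv : (γ s).IsVertex
  swap
  · exact mem_of_isTree hT h0 h1 hγ hS hx hy hs hv
  by_contra hpS
  generalize dist T.x T.y = L at *
  have hsL : s < L := lt_of_le_of_ne hs.2 fun h => hpS (by rw [h, h1]; exact hy)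
  have hnhds := (hγ.continuousOn s hs).preimage_mem_nhdsWithin (hcl.isOpen_compl.mem_nhds hpS)
  -- Distinct vertices are at distance at least 1, so `γ` meets no vertex on `(s, s + 1)`. Those
  -- points lie in the closed set `S`, and hence so does their limit `γ s`.
  have hlt : s < min L (s + 1) := lt_min hsL (by linarith)
  have hIoo : Set.Ioo s (min L (s + 1)) ⊆ Set.Icc 0 L := fun r hr =>
    ⟨hs.1.trans hr.1.le, hr.2.le.trans (min_le_left _ _)⟩
  have : (nhdsWithin s (Set.Ioo s (min L (s + 1)))).NeBot := by
    rw [nhdsWithin_Ioo_eq_nhdsGT hlt]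
    infer_instance
  obtain ⟨r, hr, hr'⟩ := Filter.nonempty_of_mem
    (Filter.inter_mem (nhdsWithin_mono s hIoo hnhds) self_mem_nhdsWithin)
  have hr1 : r < s + 1 := hr'.2.trans_le (min_le_right _ _)
  refine hr (mem_of_isTree hT h0 h1 hγ hS hx hy (hIoo hr') fun hv' => ?_)
  obtain ⟨u, hu⟩ := isVertex_iff.mp hv
  obtain ⟨v, hv⟩ := isVertex_iff.mp hv'
  have hd := hγ s hs r (hIoo hr')
  rw [hu, hv, dist_vtx_vtx, abs_sub_comm, abs_of_pos (by linarith [hr'.1])] at hd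
  have k1 : (0 : ℝ) < G.dist u v := by linarith [hr'.1]
  have k2 : (G.dist u v : ℝ) < 1 := by linarith
  have k1' : 0 < G.dist u v := by exact_mod_cast k1
  have k2' : G.dist u v < 1 := by exact_mod_cast k2
  omega

/-! ### Arbitrary geodesic triangles -/

/-- The vertices `u` and `v` are joined by a geodesic in the `r`-neighborhood of `S`. -/
def JoinedNear (S : Set (MetricGraph G hG)) (u v : V) (r : ℝ≥0∞) : Prop :=
  ∃ R, IsGeodesicSegment (vtx G hG u) (vtx G hG v) R ∧ ∀ q ∈ R, Metric.infEDist q S ≤ r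

theorem JoinedNear.mono {u v : V} {r r' : ℝ≥0∞} (h : JoinedNear S u v r) (hr : r ≤ r') :
    JoinedNear S u v r' :=
  ⟨h.choose, h.choose_spec.1, fun q hq => (h.choose_spec.2 q hq).trans hr⟩

theorem JoinedNear.symm {u v : V} {r : ℝ≥0∞} (h : JoinedNear S u v r) : JoinedNear S v u r :=
  ⟨h.choose, h.choose_spec.1.symm, h.choose_spec.2⟩

/-- One triangle with corners in `V` costs one `δ_v`. The bound holds for every geodesic `Q` from
`u` to `w`, so it applies to a prescribed side as well as to an auxiliary diagonal. -/
theorem JoinedNear.infEDist_le {u v w : V} {r : ℝ≥0∞} (h : JoinedNear S u v r)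
    (h' : JoinedNear S v w r) {Q : Set (MetricGraph G hG)}
    (hQ : IsGeodesicSegment (vtx G hG u) (vtx G hG w) Q) {p : MetricGraph G hG} (hp : p ∈ Q) :
    Metric.infEDist p S ≤ vertexHypConst G hG + r := by
  obtain ⟨A, hA, hA'⟩ := h
  obtain ⟨B, hB, hB'⟩ := h'
  refine infEDist_le_add (hB.symm.isCompact.union hA.isCompact) ⟨_, Or.inl hB.left_mem⟩
    (infEDist_le_of_vertex_triangle hQ hB.symm hA hp) ?_
  rintro q (hq | hq)
  · exact hB' q hq
  · exact hA' q hq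

theorem JoinedNear.trans {u v w : V} {r : ℝ≥0∞} (h : JoinedNear S u v r)
    (h' : JoinedNear S v w r) : JoinedNear S u w (vertexHypConst G hG + r) := by
  obtain ⟨Q, hQ⟩ := exists_isGeodesicSegment hG u w
  exact ⟨Q, hQ, fun p hp => h.infEDist_le h' hQ hp⟩

theorem infEDist_le_one {x q : MetricGraph G hG} (hx : x ∈ S) (h : dist q x ≤ 1) :
    Metric.infEDist q S ≤ 1 := by
  refine (Metric.infEDist_le_edist_of_mem hx).trans ?_
  rw [edist_dist, ← ENNReal.ofReal_one]
  exact ENNReal.ofReal_le_ofReal h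

theorem joinedNear_of_ne_zero {x : MetricGraph G hG} (hx : x ∈ S) {u v : V} (hu : x.1 u ≠ 0)
    (hv : x.1 v ≠ 0) : JoinedNear S u v 1 := by
  rcases eq_or_ne u v with rfl | huv
  · refine ⟨_, IsGeodesicSegment.refl _, fun q hq => infEDist_le_one hx ?_⟩
    rw [Set.mem_singleton_iff.mp hq, dist_comm, dist_vtx_of_ne_zero x hu]
    linarith [x.nonneg u]
  · have hadj := (x.adj_of_ne_zero hu hv huv).1
    refine ⟨_, isGeodesicSegment_edgeSet hadj, fun q hq => infEDist_le_one hx ?_⟩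
    rw [dist_eq_abs hadj hq (x.support_subset_pair huv hu hv), abs_le]
    constructor <;> linarith [x.nonneg u, x.le_one u, q.nonneg u, q.le_one u]

/-- A geodesic without vertices stays inside an edge. -/
theorem coord_ne_zero_of_no_vertex {x y : MetricGraph G hG} {R : Set (MetricGraph G hG)}
    (hR : IsGeodesicSegment x y R) (hv : ∀ q ∈ R, ¬ q.IsVertex) {u : V} (hu : x.1 u ≠ 0) :
    ∀ q ∈ R, q.1 u ≠ 0 ∧ dist x q ≤ 1 := by
  have hxR := hR.left_mem
  obtain ⟨v, huv, hvx⟩ : ∃ v, G.Adj u v ∧ x.1 v ≠ 0 := by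
    obtain ⟨a, b, hab, ha, hb⟩ := x.isVertex_or.resolve_left (hv x hxR)
    rcases x.support_subset_pair hab.ne ha hb hu with rfl | h
    · exact ⟨b, hab, hb⟩
    · obtain rfl : u = b := h
      exact ⟨a, hab.symm, ha⟩
  -- Away from vertices, the open edge and the set where some other coordinate is nonzero are
  -- disjoint, open and cover `R`; connectedness selects the first.
  have hsub : R ⊆ {q | q.1 u ≠ 0} ∩ {q | q.1 v ≠ 0} := by
    refine hR.isPreconnected.subset_left_of_subset_union
      (v := ⋃ w ∈ ({u, v} : Set V)ᶜ, {q | q.1 w ≠ 0})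
      ((isOpen_coord_ne_zero u).inter (isOpen_coord_ne_zero v))
      (isOpen_biUnion fun w _ => isOpen_coord_ne_zero w) ?_ ?_ ⟨x, hxR, hu, hvx⟩
    · rw [Set.disjoint_left]
      rintro q ⟨hqu, hqv⟩ hq
      simp only [Set.mem_iUnion, exists_prop] at hq
      obtain ⟨w, hw, hqw⟩ := hq
      exact hw (q.support_subset_pair huv.ne hqu hqv hqw)
    · intro q hq
      by_cases hs : q.1.support ⊆ {u, v}
      · have hsum := q.sum_eq_one huv.ne hs
        refine Or.inl ⟨fun h => hv q hq ⟨v, ?_⟩, fun h => hv q hq ⟨u, ?_⟩⟩ <;> linarith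
      · obtain ⟨w, hw, hw'⟩ := Set.not_subset.mp hs
        refine Or.inr ?_
        simp only [Set.mem_iUnion, exists_prop]
        exact ⟨w, hw', hw⟩
  intro q hq
  obtain ⟨hqu, hqv⟩ := hsub hq
  refine ⟨hqu, ?_⟩
  rw [dist_eq_abs huv (x.support_subset_pair huv.ne hu hvx)
    (q.support_subset_pair huv.ne hqu hqv), abs_le]
  constructor <;> linarith [x.nonneg u, x.le_one u, q.nonneg u, q.le_one u]

/-- The first vertex on a geodesic is an endpoint of the edge in which the geodesic starts. -/
theorem exists_first_vertex {x : MetricGraph G hG} {γ : ℝ → MetricGraph G hG} {L : ℝ}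
    (h0 : γ 0 = x) (hγ : IsUnitSpeedGeodesic γ L) {r : ℝ} (hr : r ∈ Set.Icc 0 L)
    (hv : (γ r).IsVertex) : ∃ s ∈ Set.Icc 0 r, ∃ u, γ s = vtx G hG u ∧ x.1 u ≠ 0 ∧
      ∀ t ∈ Set.Icc 0 s, dist (γ t) x ≤ 1 := by
  have hK : IsCompact (Set.Icc 0 L ∩ γ ⁻¹' {q | q.IsVertex}) :=
    isCompact_Icc.of_isClosed_subset
      (hγ.continuousOn.preimage_isClosed_of_isClosed isClosed_Icc isClosed_isVertex)
      Set.inter_subset_left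
  obtain ⟨s, ⟨hs, hsv⟩, hmin⟩ := hK.exists_isLeast ⟨r, hr, hv⟩
  obtain ⟨u, hu⟩ := isVertex_iff.mp hsv
  have hsr : s ≤ r := hmin ⟨hr, hv⟩
  have hxu : x.1 u ≠ 0 := by
    rcases hs.1.eq_or_lt with rfl | hs0
    · rw [← h0, hu]
      exact vtx_ne_zero.mpr rfl
    -- Less than 1 before reaching `u`, the geodesic is on an edge at `u`. No vertex occurs on `[0,
    -- t]`, so it was on that edge from the start.
    obtain ⟨t, ht, hts⟩ : ∃ t, max 0 (s - 1) < t ∧ t < s :=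
      exists_between (max_lt hs0 (by linarith))
    obtain ⟨ht0, ht1⟩ := max_lt_iff.mp ht
    have htI : t ∈ Set.Icc 0 L := ⟨ht0.le, hts.le.trans hs.2⟩
    have hd := hγ t htI s hs
    rw [abs_sub_comm, abs_of_pos (by linarith), hu] at hd
    have hc := coord_of_dist_lt_one (hd.trans_lt (by linarith))
    have hseg := (hγ.isGeodesicSegment le_rfl ht0.le htI.2).symm
    refine h0 ▸ (coord_ne_zero_of_no_vertex hseg ?_ hc.2 _ hseg.right_mem).1
    rintro q ⟨k, hk, rfl⟩ hqv
    have := hmin ⟨⟨hk.1, hk.2.trans htI.2⟩, hqv⟩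
    linarith [hk.2]
  refine ⟨s, ⟨hs.1, hsr⟩, u, hu, hxu, fun t ht => ?_⟩
  have h0L : (0 : ℝ) ∈ Set.Icc 0 L := ⟨le_rfl, hs.1.trans hs.2⟩
  have e1 := hγ t ⟨ht.1, ht.2.trans hs.2⟩ 0 h0L
  have e2 := hγ s hs 0 h0L
  rw [h0, hu, dist_comm, x.dist_vtx_of_ne_zero hxu, sub_zero, abs_of_nonneg hs.1] at e2
  rw [h0, sub_zero, abs_of_nonneg ht.1] at e1
  linarith [x.nonneg u, ht.2]

/-- `Q` is the part of `R` between its first and last vertices; the trimmed ends stay within 1 of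
`x` or `y`. With no vertex on it, `R` lies inside one open edge. -/
theorem geodesic_cases {x y : MetricGraph G hG} {R : Set (MetricGraph G hG)}
    (hR : IsGeodesicSegment x y R) :
    ((∀ u, x.1 u ≠ 0 → y.1 u ≠ 0) ∧ ∀ p ∈ R, dist p x ≤ 1) ∨
    ∃ u v Q, x.1 u ≠ 0 ∧ y.1 v ≠ 0 ∧ Q ⊆ R ∧ IsGeodesicSegment (vtx G hG u) (vtx G hG v) Q ∧
      ∀ p ∈ R, p ∈ Q ∨ dist p x ≤ 1 ∨ dist p y ≤ 1 := by
  by_cases hv : ∀ q ∈ R, ¬ q.IsVertex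
  · left
    refine ⟨fun u hu => (coord_ne_zero_of_no_vertex hR hv hu y hR.right_mem).1, fun p hp => ?_⟩
    obtain ⟨u, hu⟩ := x.exists_ne_zero
    rw [dist_comm]
    exact (coord_ne_zero_of_no_vertex hR hv hu p hp).2
  · right
    push Not at hv
    obtain ⟨q, hq, hv⟩ := hv
    obtain ⟨γ, h0, h1, hγ, rfl⟩ := hR.exists_param
    obtain ⟨r, hr, rfl⟩ := hq
    generalize dist x y = L at *
    obtain ⟨s, hs, u, hu, hxu, hle⟩ := exists_first_vertex h0 hγ hr hv
    obtain ⟨s', hs', v, hv', hyv, hle'⟩ := exists_first_vertex (x := y) (r := L - r)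
      (γ := fun t => γ (L - t)) (by simpa using h1) hγ.reverse
      ⟨by linarith [hr.2], by linarith [hr.1]⟩ (by simpa using hv)
    have hss : s ≤ L - s' := by linarith [hs.2, hs'.2]
    have hQ := hγ.isGeodesicSegment hs.1 hss (by linarith [hs'.1])
    rw [hu, hv'] at hQ
    refine ⟨u, v, _, hxu, hyv, Set.image_mono (Set.Icc_subset_Icc hs.1 (by linarith [hs'.1])),
      hQ, ?_⟩
    rintro p ⟨t, ht, rfl⟩
    rcases le_total t s with h | h
    · exact Or.inr (Or.inl (hle t ⟨ht.1, h⟩))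
    rcases le_total t (L - s') with h' | h'
    · exact Or.inl ⟨t, ⟨h, h'⟩, rfl⟩
    · have := hle' (L - t) ⟨by linarith [ht.2], by linarith⟩
      rw [sub_sub_cancel] at this
      exact Or.inr (Or.inr this)

/-- The first vertex `u'` of `R` may differ from `u`, but both are ends of the edge of `x`. Crossing
from `u` to `u'` stays within 1 of `S`, following `R` costs nothing, and one triangle combines the
two. -/
theorem exists_joinedNear {x z : MetricGraph G hG} {R : Set (MetricGraph G hG)}
    (hR : IsGeodesicSegment x z R) (hRS : R ⊆ S) {u : V} (hu : x.1 u ≠ 0) :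
    ∃ w, z.1 w ≠ 0 ∧ JoinedNear S u w (vertexHypConst G hG + 1) := by
  have hx := hRS hR.left_mem
  rcases geodesic_cases hR with ⟨h, -⟩ | ⟨u', w, Q, hu', hw, hQ, hQ', -⟩
  · exact ⟨u, h u hu, (joinedNear_of_ne_zero hx hu hu).mono le_add_self⟩
  · refine ⟨w, hw, (joinedNear_of_ne_zero hx hu hu').trans ⟨Q, hQ', fun q hq => ?_⟩⟩
    rw [Metric.infEDist_zero_of_mem (hRS (hQ hq))]
    exact zero_le

/-- The hexagon argument. -/
theorem infEDist_le_of_triangle (T : GeodesicTriangle (MetricGraph G hG)) {p : MetricGraph G hG}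
    (hp : p ∈ T.xy) : Metric.infEDist p (T.yz ∪ T.zx) ≤ 3 * vertexHypConst G hG + 1 := by
  have hx : T.x ∈ T.yz ∪ T.zx := Or.inr T.isGeodesic_zx.right_mem
  have hy : T.y ∈ T.yz ∪ T.zx := Or.inl T.isGeodesic_yz.left_mem
  rcases geodesic_cases T.isGeodesic_xy with ⟨-, h⟩ | ⟨u, v, Q, hu, hv, -, hQ', h⟩
  · exact (infEDist_le_one hx (h p hp)).trans le_add_self
  rcases h p hp with h | h | h
  · obtain ⟨w, hw, hj⟩ := exists_joinedNear (S := T.yz ∪ T.zx) T.isGeodesic_zx.symm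
      Set.subset_union_right hu
    obtain ⟨w', hw', hj'⟩ := exists_joinedNear (S := T.yz ∪ T.zx) T.isGeodesic_yz.symm
      Set.subset_union_left hw
    -- The diagonals `u w` and `w w'` stay within `δ_v + 1` of the other two sides, the diagonal `u
    -- w'` within `2 δ_v + 1`, and `Q`, closed up by the short step from `w'` to `v`, within `3 δ_v
    -- + 1`.
    refine ((hj.trans hj').infEDist_le
      ((joinedNear_of_ne_zero hy hw' hv).mono (le_add_left le_add_self)) hQ' h).trans
      (le_of_eq ?_)
    ring
  · exact (infEDist_le_one hx h).trans le_add_self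
  · exact (infEDist_le_one hy h).trans le_add_self

/-- Outside the tree case, half of the additive constant is absorbed by one more `δ_v ≥ 1/2`. -/
theorem infEDist_le_four_mul (T : GeodesicTriangle (MetricGraph G hG)) {p : MetricGraph G hG}
    (hp : p ∈ T.xy) : Metric.infEDist p (T.yz ∪ T.zx) ≤ 4 * vertexHypConst G hG + 1 / 2 := by
  by_cases hT : G.IsTree
  · rw [infEDist_eq_zero_of_isTree hT T hp]
    exact zero_le
  · refine (infEDist_le_of_triangle T hp).trans ?_
    have h := (exists_triangle_of_not_isTree hG hT).2
    have h2 : ((1 / 2 : ℝ≥0) : ℝ≥0∞) = 1 / 2 := by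
      rw [ENNReal.coe_div (by norm_num)]
      norm_num
    rw [h2] at h
    calc 3 * vertexHypConst G hG + 1 = 3 * vertexHypConst G hG + (1 / 2 + 1 / 2) := by
          rw [ENNReal.add_halves]
      _ ≤ 3 * vertexHypConst G hG + (vertexHypConst G hG + 1 / 2) := by gcongr
      _ = 4 * vertexHypConst G hG + 1 / 2 := by ring

theorem thinConst_le_four_mul (T : GeodesicTriangle (MetricGraph G hG)) :
    T.thinConst ≤ 4 * vertexHypConst G hG + 1 / 2 := by
  rcases eq_or_ne (4 * vertexHypConst G hG + 1 / 2) ⊤ with h | h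
  · rw [h]
    exact le_top
  · rw [← ENNReal.coe_toNNReal h]
    refine GeodesicTriangle.thinConst_le ((GeodesicTriangle.isThin_iff _ _).mpr ?_)
    rw [ENNReal.coe_toNNReal h]
    exact ⟨fun p hp => infEDist_le_four_mul T hp, fun p hp => infEDist_le_four_mul T.rotate hp,
      fun p hp => infEDist_le_four_mul T.rotate.rotate hp⟩

/-! ### Comparison of the constants -/

theorem vertexHypConst_le_hypConst :
    vertexHypConst G hG ≤ hypConst (MetricGraph G hG) := by
  rcases eq_or_ne (hypConst (MetricGraph G hG)) ⊤ with h | h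
  · rw [h]
    exact le_top
  · rw [← ENNReal.coe_toNNReal h]
    refine iInf₂_le _ fun T _ => GeodesicTriangle.isThin_of_thinConst_le ?_
    rw [ENNReal.coe_toNNReal h]
    exact le_iSup GeodesicTriangle.thinConst T

theorem hypConst_le : hypConst (MetricGraph G hG) ≤ 4 * vertexHypConst G hG + 1 / 2 :=
  iSup_le thinConst_le_four_mul

theorem isHyperbolic_iff : IsHyperbolic (MetricGraph G hG) ↔ vertexHypConst G hG < ⊤ := by
  constructor
  · rintro ⟨δ, h⟩
    exact (iInf₂_le δ fun T _ => h T).trans_lt ENNReal.coe_lt_top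
  · intro h
    have hne : 4 * vertexHypConst G hG + 1 / 2 ≠ ⊤ :=
      ENNReal.add_ne_top.mpr ⟨ENNReal.mul_ne_top (by norm_num) h.ne, by norm_num⟩
    refine ⟨(4 * vertexHypConst G hG + 1 / 2).toNNReal, fun T =>
      GeodesicTriangle.isThin_of_thinConst_le ?_⟩
    rw [ENNReal.coe_toNNReal hne]
    exact thinConst_le_four_mul T

theorem vertexHypConst_eq_zero (h : vertexTriangles G hG = ∅) : vertexHypConst G hG = 0 := by
  refine le_antisymm ((iInf₂_le (0 : ℝ≥0) ?_).trans (by simp)) zero_le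
  simp [h]

end MetricGraph

end Graph

end GraphHyp

theorem mainTheorem12 {V : Type*} (G : SimpleGraph V) (hG : G.Connected) :
    GraphHyp.MetricGraph.vertexHypConst G hG ≤ GraphHyp.hypConst (GraphHyp.MetricGraph G hG) ∧
    GraphHyp.hypConst (GraphHyp.MetricGraph G hG) ≤
      4 * GraphHyp.MetricGraph.vertexHypConst G hG + 1 / 2 ∧
    (GraphHyp.IsHyperbolic (GraphHyp.MetricGraph G hG) ↔
      GraphHyp.MetricGraph.vertexHypConst G hG < ⊤) ∧
    (GraphHyp.IsHyperbolic (GraphHyp.MetricGraph G hG) →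
      (∃ n : ℕ, GraphHyp.MetricGraph.vertexHypConst G hG = (n : ℝ≥0∞) / 2) ∧
      (¬ G.IsTree →
        ∃ T ∈ GraphHyp.MetricGraph.vertexTriangles G hG,
          ∃ p ∈ T.xy ∩ GraphHyp.MetricGraph.vertexMidpointSet G hG,
            Metric.infEDist p (T.zx ∪ T.yz) = T.thinConst ∧
            T.thinConst = GraphHyp.MetricGraph.vertexHypConst G hG)) := by
  refine ⟨GraphHyp.MetricGraph.vertexHypConst_le_hypConst, GraphHyp.MetricGraph.hypConst_le,
    GraphHyp.MetricGraph.isHyperbolic_iff, fun h => ⟨?_, fun hT => ?_⟩⟩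
  · rcases Set.eq_empty_or_nonempty (GraphHyp.MetricGraph.vertexTriangles G hG) with he | hne
    -- Without triangles in `𝕋_v` the thinness condition is vacuous and `δ_v = 0`.
    · exact ⟨0, by simp [GraphHyp.MetricGraph.vertexHypConst_eq_zero he]⟩
    · obtain ⟨n, hn, -⟩ := GraphHyp.MetricGraph.exists_thinConst_eq_vertexHypConst
        (GraphHyp.MetricGraph.isHyperbolic_iff.mp h) hne
      refine ⟨n, hn.trans ?_⟩
      rw [ENNReal.coe_div (by norm_num)]
      norm_num
  · obtain ⟨-, -, T, hT, p, hp, h1, h2⟩ :=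
      GraphHyp.MetricGraph.exists_thinConst_eq_vertexHypConst
        (GraphHyp.MetricGraph.isHyperbolic_iff.mp h)
        (GraphHyp.MetricGraph.exists_triangle_of_not_isTree hG hT).1
    refine ⟨T, hT, p, hp, ?_, h2⟩
    rw [Set.union_comm]
    exact h1
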